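/- Let $\Phi$ be an irreducible reduced crystallographic root system with a fixed choice of positive roots $\Phi^+$ and simple roots $\Pi$, let $W$ be its Weyl group, $h$ its Coxeter number, $\theta$ its highest root (so $h=1+\mathrm{ht}(\theta)$), $Q^\vee$ the coroot lattice, and write $\alpha\prec\beta$ if $\alpha\neq\beta$ and $\beta-\alpha$ is a sum of positive roots. Let $W_a=W\ltimes Q^\vee$ be the affine Weyl group, with elements $x\tau_\lambda$ ($x\in W$, $\lambda\in Q^\vee$, $\tau_\lambda$ the translation by $\lambda$), and let $\ell$ be its length function with respect to the simple reflections $s_\alpha$ ($\alpha\in\Pi$) and $s_0=s_\theta\tau_{-\theta^\vee}$. $W_a$ acts on the affine roots $\alpha+m\delta$ ($\alpha\in\Phi$, $m\in\mathbb Z$) by $x\tau_\lambda(\alpha+m\delta)=x(\alpha)+(m+\langle\alpha,\lambda\rangle)\delta$; the affine root $\alpha+m\delta$ is positive if either $\alpha\in\Phi^+$ and $m>0$, or $-\alpha\in\Phi^+$ and $m\ge 0$, and negative otherwise. For $w\in W_a$ let $N(w)$ be the set of positive affine roots made negative by $w^{-1}$, and let $\mathrm{supp}(w)$ be the set of $\alpha\in\Phi$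 such that $\alpha+m\delta\in N(w)$ for some $m$. An ideal is a subset $\mathcal I\subset\Phi^+$ such that $\alpha\in\mathcal I$, $\beta\in\Phi^+$, $\alpha+\beta\in\Phi^+$ imply $\alpha+\beta\in\mathcal I$; it is strictly positive if $\mathcal I\cap\Pi=\emptyset$. Let $ST(\mathcal I)=\{w\in W_a : \mathrm{supp}(w)=\mathcal I\}$, and let $\mathcal I_{min}$ be the set of minimal elements of $\mathcal I$ for $\prec$. Let $\Phi_k$ denote the set of roots of height $k$. For $t\in\{h+1,h-1\}$ write $t=ah+b$ with $1\le b<h$ (so $(a,b)=(1,1)$ for $t=h+1$ and $(a,b)=(0,h-1)$ for $t=h-1$), and let $$D^t=\{\lambda\in Q^\vee : \langle\alpha,\lambda\rangle\le a\ \text{for}\ \alpha\in\Phi_b,\ \langle\alpha,\lambda\rangle\le a+1\ \text{for}\ \alpha\in\Phi_{b-h}\}.$$ For $\lambda\in D^t$ let $$B_{t,\lambda}=\{\alpha\in\Phi_b : \langle\alpha,\lambda\rangle=a\}\cup\{\alpha\in\Phi_{b-h} : \langle\alpha,\lambda\rangle=a+1\}.$$ Let $\mathcal I$ be an ideal. (1)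 $ST(\mathcal I)$ has a unique element $w_{min}$ of minimal length. Write $w_{min}=x\tau_\lambda$ with $x\in W$ and $\lambda\in Q^\vee$. Then $\lambda\in D^{h+1}$, and for every $\alpha\in\Phi^+$ we have $\alpha\in\mathcal I_{min}$ if and only if $x^{-1}(\alpha)\in B_{h+1,\lambda}$. (2) Suppose that $\mathcal I$ is strictly positive. Then $ST(\mathcal I)$ has a unique element $w_{max}$ of maximal length. Write $w_{max}=x\tau_\lambda$ with $x\in W$ and $\lambda\in Q^\vee$. Then $\lambda\in D^{h-1}$, and for every $\alpha\in\Phi^+$, $\alpha$ is a maximal element of $\Phi^+\setminus\mathcal I$ for $\prec$ if and only if $x^{-1}(\alpha)\in B_{h-1,\lambda}$. -/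

import Mathlib

noncomputable section

namespace ShiIdeal

variable {ι M N : Type*} [AddCommGroup M] [Module ℝ M] [AddCommGroup N] [Module ℝ N]

/-! ### The affine Weyl group as the semidirect product of the Weyl group and the coroot lattice -/

section AffineWeyl

variable (P : RootPairing ι ℝ M N)

/-- The action of the Weyl group on the space `V` spanned by the coroots: the element `x` acts by
the inverse transpose of its action on the span of the roots. -/
def weylOnV : P.weylGroup →* (N ≃ₗ[ℝ] N) where
  toFun x := RootPairing.Equiv.coweightEquiv P P ((x⁻¹ : P.weylGroup) : P.Aut)
  map_one' := by
    ext v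
    simp only [inv_one, Subgroup.coe_one]
    rfl
  map_mul' x y := by
    ext v
    simp only [mul_inv_rev, Subgroup.coe_mul]
    rfl

/-- The pairing of roots and coroots is invariant under the Weyl group. -/
lemma weylOnV_pairing (x : P.weylGroup) (i : ι) (v : N) :
    P.root' (x • i) (weylOnV P x v) = P.root' i v := by
  have h1 : P.root (x • i) = (x : P.Aut).weightMap (P.root i) :=
    (RootPairing.Hom.root_weightMap_apply (P := P) (Q := P) i (x : P.Aut).toHom).symm
  have h2 := LinearMap.congr_fun (LinearMap.congr_fun (x : P.Aut).weight_coweight_transpose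
    (weylOnV P x v)) (P.root i)
  have h3 : (x : P.Aut).coweightMap (weylOnV P x v) = v := by
    simp [weylOnV]
  simp only [LinearMap.comp_apply, LinearMap.dualMap_apply] at h2
  rw [h3] at h2
  simpa [RootPairing.root', h1] using h2

/-- A reflection of the Weyl group acts on `V` by `v ↦ v - ⟨α, v⟩ α^∨`. -/
lemma weylOnV_ofIdx (i : ι) (v : N) :
    weylOnV P (RootPairing.weylGroup.ofIdx P i) v = v - P.root' i v • P.coroot i := by
  have : (RootPairing.weylGroup.ofIdx P i)⁻¹ = RootPairing.weylGroup.ofIdx P i := by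
    apply Subtype.ext
    exact RootPairing.Equiv.reflection_inv P i
  simp only [weylOnV, MonoidHom.coe_mk, OneHom.coe_mk, this]
  exact RootPairing.coreflection_apply P i v

lemma weylOnV_mem (x : P.weylGroup) (v : N) (hv : v ∈ P.corootSpan ℤ) :
    weylOnV P x v ∈ P.corootSpan ℤ := by
  induction hv using Submodule.span_induction with
  | mem v hv =>
    obtain ⟨i, rfl⟩ := hv
    have : weylOnV P x (P.coroot i) = P.coroot (x • i) := by
      simp only [weylOnV, MonoidHom.coe_mk, OneHom.coe_mk, RootPairing.Equiv.coweightEquiv_apply,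
        RootPairing.Hom.coroot_coweightMap_apply]
      rfl
    rw [this]
    exact Submodule.subset_span ⟨_, rfl⟩
  | zero => simp
  | add y z _ _ hy hz => simpa using Submodule.add_mem _ hy hz
  | smul n y _ hy => simpa using Submodule.smul_mem _ n hy

/-- The action of the Weyl group on the coroot lattice. -/
def weylOnCorootLattice (x : P.weylGroup) (v : P.corootSpan ℤ) : P.corootSpan ℤ :=
  ⟨weylOnV P x v, weylOnV_mem P x v v.2⟩

/-- The action of the Weyl group on the coroot lattice by group automorphisms (the lattice being
written multiplicatively). -/
def weylHom : P.weylGroup →* MulAut (Multiplicative (P.corootSpan ℤ)) where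
  toFun x :=
    { toFun := fun v => Multiplicative.ofAdd (weylOnCorootLattice P x v.toAdd)
      invFun := fun v => Multiplicative.ofAdd (weylOnCorootLattice P x⁻¹ v.toAdd)
      left_inv := fun v => by
        apply Multiplicative.toAdd.injective
        apply Subtype.ext
        simp [weylOnCorootLattice]
      right_inv := fun v => by
        apply Multiplicative.toAdd.injective
        apply Subtype.ext
        simp [weylOnCorootLattice]
      map_mul' := fun v w => by
        apply Multiplicative.toAdd.injective
        apply Subtype.ext
        simp [weylOnCorootLattice] }
  map_one' := by
    ext v
    simp [weylOnCorootLattice]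
  map_mul' x y := by
    ext v
    simp [weylOnCorootLattice]

/-- The affine Weyl group `W_a`, the semidirect product of the Weyl group and the coroot lattice. -/
abbrev AffineWeylGroup : Type _ := Multiplicative (P.corootSpan ℤ) ⋊[weylHom P] P.weylGroup

/-- The element `x τ_l` of `W_a`: translate by `l`, then apply `x`. Every element of `W_a` has a
unique expression of this form. -/
def mulTranslation (x : P.weylGroup) (l : P.corootSpan ℤ) : AffineWeylGroup P :=
  SemidirectProduct.inr x * SemidirectProduct.inl (Multiplicative.ofAdd l)

lemma existsUnique_mulTranslation (w : AffineWeylGroup P) :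
    ∃! p : P.weylGroup × P.corootSpan ℤ, w = mulTranslation P p.1 p.2 := by
  refine ⟨(w.right, ((weylHom P w.right)⁻¹ w.left).toAdd), ?_, ?_⟩
  · ext <;> simp [mulTranslation]
  · rintro ⟨x, l⟩ rfl
    ext <;> simp [mulTranslation]

variable [P.IsCrystallographic]

/-- Affine roots `α + m δ` are encoded as pairs `(α, m)`. The action of `W_a` on them: the
finite Weyl group acts on the first entry, and the translation by `l` sends `α + m δ` to
`α + (m + ⟨α, l⟩) δ`. -/
instance affineRootAction : MulAction (AffineWeylGroup P) (ι × ℤ) where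
  smul w a := (w.right • a.1, a.2 + P.root'In ℤ (w.right • a.1) w.left.toAdd)
  one_smul a := by
    apply Prod.ext
    · exact one_smul _ a.1
    · change a.2 + P.root'In ℤ _ 0 = a.2
      simp
  mul_smul w u a := by
    apply Prod.ext
    · exact mul_smul _ _ a.1
    · change a.2 + P.root'In ℤ ((w.right * u.right) • a.1)
          (w.left.toAdd + weylOnCorootLattice P w.right u.left.toAdd) =
        a.2 + P.root'In ℤ (u.right • a.1) u.left.toAdd +
          P.root'In ℤ (w.right • u.right • a.1) w.left.toAdd
      have : P.root'In ℤ (w.right • u.right • a.1)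
          (weylOnCorootLattice P w.right u.left.toAdd) =
          P.root'In ℤ (u.right • a.1) u.left.toAdd := by
        apply FaithfulSMul.algebraMap_injective ℤ ℝ
        rw [RootPairing.algebraMap_root'In_apply, RootPairing.algebraMap_root'In_apply]
        exact weylOnV_pairing P w.right _ _
      rw [mul_smul, map_add, this]
      ring

/-- `x τ_l (α + m δ) = x(α) + (m + ⟨α, l⟩) δ`. -/
lemma mulTranslation_smul (x : P.weylGroup) (l : P.corootSpan ℤ) (i : ι) (m : ℤ) :
    mulTranslation P x l • (i, m) = (x • i, m + P.root'In ℤ i l) := by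
  rw [mulTranslation, mul_smul]
  apply Prod.ext
  · change x • (1 : P.weylGroup) • i = x • i
    simp
  · change m + P.root'In ℤ ((1 : P.weylGroup) • i) l + P.root'In ℤ _ 0 = _
    simp

end AffineWeyl

/-! ### Simple reflections, length, inversion sets and supports -/

section Based

variable {P : RootPairing ι ℝ M N} (b : P.Base)

/-- `α ≺ β`: the roots are distinct and `β - α` is a sum of positive roots. -/
def Prec (i j : ι) : Prop :=
  i ≠ j ∧ P.root j - P.root i ∈ AddSubmonoid.closure (P.root '' {k | b.IsPos k})

/-- The highest root: it is positive and lies above every other root. -/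
def IsHighestRoot (t : ι) : Prop := b.IsPos t ∧ ∀ i, i ≠ t → Prec b i t

/-- The Coxeter number: one plus the largest height of a root, that is, one plus the height of the
highest root. -/
def coxeterNumber : ℕ := 1 + sSup (Set.range fun i => (b.height i).toNat)

/-- The set `S` of simple reflections of `W_a`: the reflections `s_i` in the simple roots, and
`s_0 = s_θ τ_{-θ^∨}` where `θ` is the highest root. -/
def simpleReflections : Set (AffineWeylGroup P) :=
  {s | ∃ i ∈ b.support, s = mulTranslation P (RootPairing.weylGroup.ofIdx P i) 0} ∪
  {s | ∃ t, IsHighestRoot b t ∧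
    s = mulTranslation P (RootPairing.weylGroup.ofIdx P t) (-P.corootSpanMem ℤ t)}

/-- The length of `w`: the least length of a word in the simple reflections with product `w`. -/
def length (w : AffineWeylGroup P) : ℕ :=
  sInf {n | ∃ L : List (AffineWeylGroup P),
    (∀ s ∈ L, s ∈ simpleReflections b) ∧ L.prod = w ∧ L.length = n}

/-- The affine root `α + m δ` is positive if either `α` is positive and `m > 0`, or `-α` is positive
and `m ≥ 0`. -/
def IsPosAffine (a : ι × ℤ) : Prop :=
  (b.IsPos a.1 ∧ 0 < a.2) ∨ (b.IsPos (P.reflectionPerm a.1 a.1) ∧ 0 ≤ a.2)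

variable [P.IsCrystallographic]

/-- `N(w)`: the positive affine roots that `w⁻¹` makes negative. -/
def inversionSet (w : AffineWeylGroup P) : Set (ι × ℤ) :=
  {a | IsPosAffine b a ∧ ¬ IsPosAffine b (w⁻¹ • a)}

/-- `supp(w)`: the roots `α` with `α + m δ ∈ N(w)` for some `m`. -/
def supp (w : AffineWeylGroup P) : Set ι := {i | ∃ m : ℤ, (i, m) ∈ inversionSet b w}

/-- `ST(I)`: the elements of `W_a` with support `I`. -/
def signType (I : Set ι) : Set (AffineWeylGroup P) := {w | supp b w = I}

/-- `w` has minimal length in `ST(I)`. -/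
def IsMinElement (I : Set ι) (w : AffineWeylGroup P) : Prop :=
  w ∈ signType b I ∧ ∀ u ∈ signType b I, length b w ≤ length b u

/-- `w` has maximal length in `ST(I)`. -/
def IsMaxElement (I : Set ι) (w : AffineWeylGroup P) : Prop :=
  w ∈ signType b I ∧ ∀ u ∈ signType b I, length b u ≤ length b w

/-- The set `D^t`, where `t = a h + c` with `a = t / h` and `c = t % h`: the coroot lattice points
`l` with `⟨α, l⟩ ≤ a` for the roots `α` of height `c` and `⟨α, l⟩ ≤ a + 1` for the roots `α` of
height `c - h`. -/
def latticeSimplex (t : ℕ) : Set (P.corootSpan ℤ) :=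
  {l | (∀ i, b.height i = ((t % coxeterNumber b : ℕ) : ℤ) →
      P.root'In ℤ i l ≤ ((t / coxeterNumber b : ℕ) : ℤ)) ∧
    (∀ i, b.height i = ((t % coxeterNumber b : ℕ) : ℤ) - (coxeterNumber b : ℤ) →
      P.root'In ℤ i l ≤ ((t / coxeterNumber b : ℕ) : ℤ) + 1)}

/-- The set `B_{t,l}` of the roots whose hyperplanes bound the simplex of `D^t` and contain `l`:
with `t = a h + c` as above, the roots `α` of height `c` with `⟨α, l⟩ = a` and the roots `α` of
height `c - h` with `⟨α, l⟩ = a + 1`. -/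
def wallRoots (t : ℕ) (l : P.corootSpan ℤ) : Set ι :=
  {i | b.height i = ((t % coxeterNumber b : ℕ) : ℤ) ∧
      P.root'In ℤ i l = ((t / coxeterNumber b : ℕ) : ℤ)} ∪
  {i | b.height i = ((t % coxeterNumber b : ℕ) : ℤ) - (coxeterNumber b : ℤ) ∧
      P.root'In ℤ i l = ((t / coxeterNumber b : ℕ) : ℤ) + 1}

end Based

/-! ### Ideals of positive roots -/

section Ideals

variable {P : RootPairing ι ℝ M N} (b : P.Base)

/-- An ideal of the positive roots: a set of positive roots such that `α + β` is in it whenever `α`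
is in it, `β` is a positive root and `α + β` is a positive root. -/
def IsRootIdeal (I : Set ι) : Prop :=
  (∀ i ∈ I, b.IsPos i) ∧
  ∀ i ∈ I, ∀ j, b.IsPos j → ∀ k, b.IsPos k → P.root k = P.root i + P.root j → k ∈ I

/-- An ideal is strictly positive if it contains no simple root. -/
def IsStrictlyPositive (I : Set ι) : Prop := ∀ i ∈ b.support, i ∉ I

/-- The minimal roots of `I`. -/
def minimalRoots (I : Set ι) : Set ι :=
  {i | i ∈ I ∧ ∀ j, b.IsPos j → Prec b j i → j ∉ I}

/-- The maximal roots of the complement of `I` in the positive roots. -/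
def maximalRootsCompl (I : Set ι) : Set ι :=
  {i | b.IsPos i ∧ i ∉ I ∧ ∀ j, b.IsPos j → j ∉ I → ¬ Prec b i j}

end Ideals

end ShiIdeal

end

/-! Give the affine root `α + m δ` the height `h m - ht(α)`. Since `|ht(α)| < h`, this never
vanishes, its sign decides positivity, and the affine roots of height one are the `-α` with `α`
simple together with `θ + δ`. Being the restriction of a linear functional, it reduces positivity
questions to integer arithmetic. The usual theory follows: length is the number of inversions
(`length_eq_ncard_inversionSet`), `N(w)` determines `w`, and every finite biconvex set is some
`N(w)` (`IsBiconvex.exists_inversionSet_eq`).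

For an ideal `I` let `I^n` be the set of roots that are sums of `n` elements of `I`, and let `C_n`
be the set of positive roots that are sums of at most `n` positive roots outside `I`. If `u` has
support `I`, additivity of heights under `u⁻¹` forces `α + n δ ∈ N(u)` for `n > 0` and `α ∈ I^n`,
and forbids it for `α ∈ C_n`. The two extreme sets allowed by these constraints are biconvex (the
second one is finite only for strictly positive `I`), hence are the inversion sets of elements of
`ST(I)`. All other inversion sets in `ST(I)` lie between them, which gives existence and uniqueness
of `w_min` and `w_max`.

An affine root `p` with `w⁻¹ p` of height `±1` is a wall of the alcove of `w`. A wall of `w_min`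
with `w⁻¹ p` of height `-1`, or of `w_max` with height `1`, cannot lie above level one: its finite
part would split off a root of `I`, respectively of the complement, and a sum of two negative
(positive) integers is not `-1` (`1`). Written in coordinates `w = x τ_λ`, this is `λ ∈ D^{h±1}`.
The walls at level exactly one are the minimal roots of `I`, respectively the maximal roots of the
complement: a nontrivial splitting of `w⁻¹(α + δ)`, transported by `w`, would contradict minimality
or maximality of `α`. -/

noncomputable section

namespace ShiIdeal

/-! ### Finite root systems: sums of roots, dominant roots, the highest root. -/

section RootLemmas

variable {ι M N : Type*} [AddCommGroup M] [Module ℝ M] [AddCommGroup N] [Module ℝ N]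
  {P : RootPairing ι ℝ M N}

lemma root_neg (i : ι) : P.root (P.reflectionPerm i i) = - P.root i := by simp

lemma height_neg (b : P.Base) (i : ι) : b.height (P.reflectionPerm i i) = - b.height i :=
  b.height_reflectionPerm_self i

lemma isPos_neg_iff (b : P.Base) (i : ι) : b.IsPos (P.reflectionPerm i i) ↔ ¬ b.IsPos i :=
  RootPairing.Base.IsPos.neg_iff_not b i

lemma root_nonneg_coeff (b : P.Base) {i : ι} (hi : b.IsPos i) :
    ∃ f : ι → ℤ, (∀ j, 0 ≤ f j) ∧ (∃ j ∈ b.support, f j ≠ 0) ∧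
      P.root i = ∑ j ∈ b.support, f j • P.root j := by
  obtain ⟨f, hf₀, hf₁, hf₂⟩ := b.exists_root_eq_sum_int i
  have hf : 0 < f := by
    refine hf₁.resolve_right fun h => ?_
    rw [RootPairing.Base.isPos_iff, RootPairing.Base.height_eq_sum hf₂] at hi
    exact absurd hi (not_lt.2 (Finset.sum_nonpos fun i _ ↦ h.le i))
  refine ⟨f, fun j => hf.le j, ?_, hf₂⟩
  by_contra! h
  apply P.ne_zero i
  rw [hf₂]
  exact Finset.sum_eq_zero fun j hj => by simp [h j hj]

lemma pairingIn_sum [P.IsCrystallographic] (b : P.Base) {i : ι} {f : ι → ℤ}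
    (h : P.root i = ∑ j ∈ b.support, f j • P.root j) (k : ι) :
    P.pairingIn ℤ i k = ∑ j ∈ b.support, f j * P.pairingIn ℤ j k := by
  apply FaithfulSMul.algebraMap_injective ℤ ℝ
  simp_rw [RootPairing.algebraMap_pairingIn, map_sum, ← P.root_coroot_eq_pairing, h, map_sum,
    map_zsmul, LinearMap.coe_sum, Finset.sum_apply, LinearMap.smul_apply,
    RootPairing.root_coroot_eq_pairing, zsmul_eq_mul, map_mul, RootPairing.algebraMap_pairingIn]
  simp

variable [Finite ι] [P.IsCrystallographic]

/-- If a sum of two roots equals a sum of two roots and is a root, then one of the differences of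
a summand on the left and a summand on the right is zero or a root. -/
lemma exists_sub_of_add_eq_add {i j k l p : ι} (hp : P.root p = P.root i + P.root j)
    (hp' : P.root p = P.root k + P.root l) :
    (i = k ∨ ∃ r, P.root r = P.root i - P.root k) ∨
    (i = l ∨ ∃ r, P.root r = P.root i - P.root l) := by
  have key : ∀ {u v : ι}, 0 < P.pairingIn ℤ u v → u = v ∨ ∃ r, P.root r = P.root u - P.root v := by
    intro u v h
    by_cases huv : u = v
    · exact Or.inl huv
    · exact Or.inr (P.root_sub_root_mem_of_pairingIn_pos h huv)
  have main : ∀ {u : ι}, 0 < P.pairingIn ℤ u p →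
      (u = k ∨ ∃ r, P.root r = P.root u - P.root k) ∨
      (u = l ∨ ∃ r, P.root r = P.root u - P.root l) := by
    intro u hu
    rw [P.zero_lt_pairingIn_iff'] at hu
    rw [RootPairing.pairingIn_eq_add_of_root_eq_add hp'] at hu
    rcases (by lia : 0 < P.pairingIn ℤ k u ∨ 0 < P.pairingIn ℤ l u) with h | h
    · exact Or.inl (key ((P.zero_lt_pairingIn_iff' ℤ).1 h))
    · exact Or.inr (key ((P.zero_lt_pairingIn_iff' ℤ).1 h))
  -- One of `i`, `j` pairs positively with `p = k + l`, hence with `k` or `l`. If it is `j`, the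
  -- identities `i - k = l - j` and `i - l = k - j` turn differences of `j` into differences of `i`.
  have h2 : P.pairingIn ℤ i p + P.pairingIn ℤ j p = 2 := by
    rw [← RootPairing.pairingIn_eq_add_of_root_eq_add hp, P.pairingIn_same]
  rcases (by lia : 0 < P.pairingIn ℤ i p ∨ 0 < P.pairingIn ℤ j p) with h | h
  · exact main h
  · have hneg : ∀ r s : ι, P.root s = P.root j - P.root r →
        P.root (P.reflectionPerm s s) = P.root r - P.root j := by
      intro r s hs
      rw [root_neg, hs, neg_sub]
    have e : P.root i - P.root k = P.root l - P.root j := by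
      have := hp.symm.trans hp'
      rw [sub_eq_sub_iff_add_eq_add, this, add_comm]
    have e' : P.root i - P.root l = P.root k - P.root j := by
      have := hp.symm.trans hp'
      rw [sub_eq_sub_iff_add_eq_add, this]
    rcases main h with (rfl | ⟨r, hr⟩) | (rfl | ⟨r, hr⟩)
    · refine Or.inr (Or.inl (P.root.injective ?_))
      simpa [sub_eq_zero] using e'
    · exact Or.inr (Or.inr ⟨_, (hneg _ _ hr).trans e'.symm⟩)
    · refine Or.inl (Or.inl (P.root.injective ?_))
      simpa [sub_eq_zero] using e
    · exact Or.inl (Or.inr ⟨_, (hneg _ _ hr).trans e.symm⟩)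

/-- If `i + j` and `i + j + k` are roots, with `i`, `j` and `k` positive, then `i + k` or `j + k` is
a root. -/
lemma exists_add_of_add_add (b : P.Base) {i j k p q : ι} (hi : b.IsPos i) (hj : b.IsPos j)
    (hk : b.IsPos k) (hp : P.root p = P.root i + P.root j) (hq : P.root q = P.root p + P.root k) :
    (∃ r, P.root r = P.root i + P.root k) ∨ ∃ r, P.root r = P.root j + P.root k := by
  have hne : ∀ {u v : ι}, b.IsPos u → b.IsPos v → P.root u ≠ - P.root v := by
    intro u v hu hv h
    have := b.height_sub (i := v) (j := v) (k := u)
    have h3 : P.root (P.reflectionPerm v v) = P.root u := by simp [h]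
    have h4 := b.height_reflectionPerm_self v
    change b.height (P.reflectionPerm v v) = _ at h4
    rw [P.root.injective h3] at h4
    rw [RootPairing.Base.isPos_iff] at hu hv
    lia
  have hsub : ∀ {u v w : ι}, 0 < P.pairingIn ℤ u q → b.IsPos v → b.IsPos w →
      P.root q = P.root u + (P.root v + P.root w) → ∃ r, P.root r = P.root v + P.root w := by
    intro u v w hu hv hw h
    rw [P.zero_lt_pairingIn_iff'] at hu
    have : q ≠ u := by
      rintro rfl
      apply hne hv hw
      have : P.root v + P.root w = 0 := by simpa using h
      exact eq_neg_of_add_eq_zero_left this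
    obtain ⟨r, hr⟩ := P.root_sub_root_mem_of_pairingIn_pos hu this
    exact ⟨r, by rw [hr, h]; abel⟩
  -- If neither sum is a root, then `⟨i, q^∨⟩` and `⟨j, q^∨⟩` are nonpositive, as otherwise `q - i`
  -- or `q - j` would be such a sum; so `⟨p, q^∨⟩ ≤ 0`. But `k` makes no obtuse angle with `i` or
  -- `j`, hence none with `p`, and `⟨q, p^∨⟩ ≥ 2`.
  by_contra hcon
  push Not at hcon
  obtain ⟨hik, hjk⟩ := hcon
  have h1 : ¬ 0 < P.pairingIn ℤ i q := fun h => by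
    obtain ⟨r, hr⟩ := hsub h hj hk (by rw [hq, hp]; abel)
    exact hjk r hr
  have h2 : ¬ 0 < P.pairingIn ℤ j q := fun h => by
    obtain ⟨r, hr⟩ := hsub h hi hk (by rw [hq, hp]; abel)
    exact hik r hr
  have hadd : ∀ {u v : ι}, b.IsPos u → b.IsPos v → (∀ r, P.root r ≠ P.root u + P.root v) →
      0 ≤ P.pairingIn ℤ u v := by
    intro u v hu hv h
    by_contra hlt
    obtain ⟨r, hr⟩ := P.root_add_root_mem_of_pairingIn_neg (not_le.1 hlt) (hne hu hv)
    exact h r hr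
  have h3 := hadd hi hk hik
  have h4 := hadd hj hk hjk
  have h5 : 0 ≤ P.pairingIn ℤ p k := by
    rw [RootPairing.pairingIn_eq_add_of_root_eq_add hp]; lia
  have h6 : 0 ≤ P.pairingIn ℤ k p := by
    by_contra h
    exact absurd ((P.pairingIn_lt_zero_iff ℤ).1 (not_le.1 h)) (not_lt.2 h5)
  have h7 : 0 < P.pairingIn ℤ q p := by
    rw [RootPairing.pairingIn_eq_add_of_root_eq_add hq, P.pairingIn_same]; lia
  rw [P.zero_lt_pairingIn_iff', RootPairing.pairingIn_eq_add_of_root_eq_add hp] at h7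
  lia

/-- The height as a linear functional. -/
lemma exists_heightFunctional [P.IsRootSystem] (b : P.Base) :
    ∃ f : M →ₗ[ℝ] ℝ, ∀ i, f (P.root i) = b.height i := by
  refine ⟨b.toWeightBasis.constr ℝ (fun _ => (1 : ℝ)), fun i => ?_⟩
  have hs : ∀ i ∈ b.support, b.toWeightBasis.constr ℝ (fun _ => (1 : ℝ)) (P.root i) = 1 := by
    intro i hi
    have := b.toWeightBasis.constr_basis ℝ (fun _ => (1 : ℝ)) ⟨i, hi⟩
    simpa using this
  induction i using b.induction_add with
  | h₀ i h => rw [root_neg, map_neg, h, height_neg, Int.cast_neg]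
  | h₁ i h => simp [hs i h, RootPairing.Base.height_one_of_mem_support h]
  | h₂ i j k hk hi hj =>
    rw [b.height_add hk, hk, map_add, hi, hs j hj, RootPairing.Base.height_one_of_mem_support hj]
    simp

/-- A positive root to which no simple root can be added is dominant. -/
lemma pairingIn_nonneg_of_forall_add (b : P.Base) {i : ι} (hi : b.IsPos i)
    (h : ∀ j ∈ b.support, ∀ k, P.root k ≠ P.root i + P.root j) {j : ι} (hj : j ∈ b.support) :
    0 ≤ P.pairingIn ℤ i j := by
  by_contra hlt
  obtain ⟨r, hr⟩ := P.root_add_root_mem_of_pairingIn_neg (not_le.1 hlt) (fun h => by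
    have h3 : P.root (P.reflectionPerm j j) = P.root i := by simp [h]
    have h4 := height_neg b j
    rw [P.root.injective h3] at h4
    have := RootPairing.Base.isPos_of_mem_support hj
    rw [RootPairing.Base.isPos_iff] at hi this
    lia)
  exact h j hj r hr

lemma pairingIn_nonneg_symm {i j : ι} (h : 0 ≤ P.pairingIn ℤ i j) : 0 ≤ P.pairingIn ℤ j i := by
  by_contra h'
  exact absurd ((P.pairingIn_lt_zero_iff ℤ).1 (not_le.1 h')) (not_lt.2 h)

variable [P.IsReduced] [P.IsIrreducible]

/-- In an irreducible root system, all coefficients of a dominant positive root are positive. -/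
lemma coeff_pos_of_dominant (b : P.Base) {i : ι} {f : ι → ℤ} (hf : ∀ j, 0 ≤ f j)
    (hne : ∃ j ∈ b.support, f j ≠ 0) (h : P.root i = ∑ j ∈ b.support, f j • P.root j)
    (hd : ∀ j ∈ b.support, 0 ≤ P.pairingIn ℤ i j) {j : ι} (hj : j ∈ b.support) : 0 < f j := by
  obtain ⟨j₀, hj₀, hj₀'⟩ := hne
  -- Positivity spreads along the edges of the connected Dynkin diagram. If `f l = 0`, then `⟨i,
  -- l^∨⟩ ≥ 0` is a sum of nonpositive terms, so all of them vanish, including the one of a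
  -- neighbour `k` with `f k > 0`.
  have := b.induction_on_cartanMatrix (fun j => 0 < f j) (i := ⟨j₀, hj₀⟩) (j := ⟨j, hj⟩)
    (lt_of_le_of_ne (hf j₀) (Ne.symm hj₀')) ?_
  · exact this
  · rintro ⟨k, hk⟩ ⟨l, hl⟩ hfk hkl
    change P.pairingIn ℤ l k ≠ 0 at hkl
    change 0 < f k at hfk
    change 0 < f l
    by_contra hfl
    have hfl : f l = 0 := le_antisymm (not_lt.1 hfl) (hf l)
    have hdl := hd l hl
    rw [pairingIn_sum b h l] at hdl
    have hle : ∀ m ∈ b.support, f m * P.pairingIn ℤ m l ≤ 0 := by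
      intro m hm
      by_cases hml : m = l
      · simp [hml, hfl]
      · have := b.pairingIn_le_zero_of_ne (i := m) (j := l) hml hm hl
        exact mul_nonpos_of_nonneg_of_nonpos (hf m) this
    have h0 := (Finset.sum_eq_zero_iff_of_nonpos hle).1
      (le_antisymm (Finset.sum_nonpos hle) hdl) k hk
    have : P.pairingIn ℤ k l ≠ 0 := by
      rw [Ne, P.pairingIn_eq_zero_iff]
      exact hkl
    rcases mul_eq_zero.1 h0 with h1 | h1
    · lia
    · exact this h1

/-- Two dominant positive roots of an irreducible root system are not orthogonal. -/
lemma pairingIn_pos_of_dominant (b : P.Base) {i k : ι} (hi : b.IsPos i) (hk : b.IsPos k)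
    (hd : ∀ j ∈ b.support, 0 ≤ P.pairingIn ℤ i j) (hd' : ∀ j ∈ b.support, 0 ≤ P.pairingIn ℤ k j) :
    0 < P.pairingIn ℤ i k := by
  obtain ⟨f, hf, hne, h⟩ := root_nonneg_coeff b hi
  rw [pairingIn_sum b h]
  obtain ⟨j, hj, hjk⟩ := hk.exists_mem_support_pos_pairingIn
  refine Finset.sum_pos' (fun j hj => mul_nonneg (hf j) (pairingIn_nonneg_symm (hd' j hj)))
    ⟨j, hj, mul_pos (coeff_pos_of_dominant b hf hne h hd hj) hjk⟩

/-- The highest root exists. -/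
lemma exists_isHighestRoot [P.IsRootSystem] (b : P.Base) : ∃ t, IsHighestRoot b t := by
  have : Nonempty ι := by
    by_contra h
    rw [not_nonempty_iff] at h
    have h1 := (RootPairing.IsRootSystem.span_root_eq_top (P := P))
    have : P.rootSpan ℝ = ⊥ := by simp [RootPairing.rootSpan, Set.range_eq_empty]
    have h2 : (⊤ : Submodule ℝ M) = ⊥ := h1.symm.trans this
    have h3 := RootPairing.IsIrreducible.nontrivial (P := P)
    exact top_ne_bot h2
  obtain ⟨s, hs⟩ := b.support_nonempty
  have hs1 : b.height s = 1 := RootPairing.Base.height_one_of_mem_support hs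
  obtain ⟨t, ht⟩ := Finite.exists_max b.height
  have htpos : b.IsPos t := by
    rw [RootPairing.Base.isPos_iff]
    have := ht s
    lia
  have hnot : ∀ j ∈ b.support, ∀ k, P.root k ≠ P.root t + P.root j := by
    intro j hj k hk
    have h1 := b.height_add hk
    have h2 := RootPairing.Base.height_one_of_mem_support hj
    have := ht k
    lia
  refine ⟨t, htpos, fun i hi => ⟨hi, ?_⟩⟩
  set C := AddSubmonoid.closure (P.root '' {k | b.IsPos k}) with hC
  have hmem : ∀ k, b.IsPos k → P.root k ∈ C := fun k hk => AddSubmonoid.subset_closure ⟨k, hk, rfl⟩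
  have : Nonempty {k | P.root k - P.root i ∈ C} := ⟨⟨i, by simp⟩⟩
  -- Choose `k` highest among the roots above `i`. Both `k` and `t` are dominant, so they are equal
  -- or `t - k` is a root, positive because `t` is highest; then `t - i = (t - k) + (k - i)`.
  obtain ⟨⟨k, hk⟩, hkmax⟩ := Finite.exists_max (fun k : {k | P.root k - P.root i ∈ C} => b.height k)
  replace hkmax : ∀ l, P.root l - P.root i ∈ C → b.height l ≤ b.height k := fun l hl => hkmax ⟨l, hl⟩
  change P.root k - P.root i ∈ C at hk
  -- If `k` were negative, `-k = k + 2(-k)` would also lie above `i` and be higher.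
  have hkpos : b.IsPos k := by
    by_contra hneg
    rw [← isPos_neg_iff] at hneg
    have h1 := hkmax (P.reflectionPerm k k) (by
      have : P.root (P.reflectionPerm k k) - P.root i =
        (P.root k - P.root i) + (P.root (P.reflectionPerm k k) + P.root (P.reflectionPerm k k)) := by
        rw [root_neg]; abel
      rw [this]
      exact add_mem hk (add_mem (hmem _ hneg) (hmem _ hneg)))
    rw [RootPairing.Base.isPos_iff] at hneg
    rw [height_neg] at h1 hneg
    lia
  have hknot : ∀ j ∈ b.support, ∀ l, P.root l ≠ P.root k + P.root j := by
    intro j hj l hl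
    have h1 := b.height_add hl
    have h2 := RootPairing.Base.height_one_of_mem_support hj
    have := hkmax l (by
      rw [hl, add_sub_right_comm]
      exact add_mem hk (hmem j (RootPairing.Base.isPos_of_mem_support hj)))
    lia
  have hpos := pairingIn_pos_of_dominant b htpos hkpos
    (fun j hj => pairingIn_nonneg_of_forall_add b htpos hnot hj)
    (fun j hj => pairingIn_nonneg_of_forall_add b hkpos hknot hj)
  by_cases htk : t = k
  · rw [htk]; exact hk
  · obtain ⟨r, hr⟩ := P.root_sub_root_mem_of_pairingIn_pos hpos htk
    have hrpos : b.IsPos r := by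
      rw [RootPairing.Base.isPos_iff', b.height_sub hr]
      have := ht k
      lia
    have : P.root t - P.root i = P.root r + (P.root k - P.root i) := by rw [hr]; abel
    rw [this]
    exact add_mem (hmem r hrpos) hk

end RootLemmas

/-! ### Affine roots as vectors and the affine reflections. -/

section AffineRoots

variable {ι M N : Type*} [AddCommGroup M] [Module ℝ M] [AddCommGroup N] [Module ℝ N]
  {P : RootPairing ι ℝ M N}

variable (P) in
/-- The affine root `α + m δ` as a vector. -/
def affineVec (a : ι × ℤ) : M × ℝ := (P.root a.1, (a.2 : ℝ))

variable (P) in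
/-- The negative of an affine root. -/
def affineNeg (a : ι × ℤ) : ι × ℤ := (P.reflectionPerm a.1 a.1, -a.2)

lemma affineVec_injective : Function.Injective (affineVec P) := by
  rintro ⟨i, m⟩ ⟨j, n⟩ h
  simp only [affineVec, Prod.mk.injEq, EmbeddingLike.apply_eq_iff_eq, Int.cast_inj] at h
  exact Prod.ext h.1 h.2

lemma affineVec_neg (a : ι × ℤ) : affineVec P (affineNeg P a) = - affineVec P a := by
  simp [affineVec, affineNeg]

lemma affineNeg_neg (a : ι × ℤ) : affineNeg P (affineNeg P a) = a :=
  affineVec_injective (P := P) (by simp [affineVec_neg])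

lemma affineVec_eq_add_iff {a b c : ι × ℤ} :
    affineVec P c = affineVec P a + affineVec P b ↔
      P.root c.1 = P.root a.1 + P.root b.1 ∧ c.2 = a.2 + b.2 := by
  simp only [affineVec, Prod.mk_add_mk, Prod.mk.injEq]
  norm_cast

lemma smul_def [P.IsCrystallographic] (w : AffineWeylGroup P) (a : ι × ℤ) :
    w • a = (w.right • a.1, a.2 + P.root'In ℤ (w.right • a.1) w.left.toAdd) := rfl

lemma weylGroup_root_smul (x : P.weylGroup) (i : ι) :
    P.root (x • i) = (x : P.Aut).weightMap (P.root i) :=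
  (RootPairing.Hom.root_weightMap_apply (P := P) (Q := P) i (x : P.Aut).toHom).symm

/-- Linearity of the action is what transports relations between affine roots from one alcove to
another. -/
lemma exists_affineMap [P.IsCrystallographic] (w : AffineWeylGroup P) :
    ∃ L : M × ℝ →ₗ[ℝ] M × ℝ, ∀ a, L (affineVec P a) = affineVec P (w • a) := by
  let T : M →ₗ[ℝ] M := (w.right : P.Aut).weightMap
  refine ⟨LinearMap.prod (T ∘ₗ LinearMap.fst ℝ M ℝ) (LinearMap.snd ℝ M ℝ +
    P.toLinearMap.flip (w.left.toAdd : N) ∘ₗ T ∘ₗ LinearMap.fst ℝ M ℝ), ?_⟩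
  rintro ⟨i, m⟩
  rw [smul_def]
  apply Prod.ext
  · simp [affineVec, weylGroup_root_smul, T]
  · have := P.algebraMap_root'In_apply ℤ (w.right • i) w.left.toAdd
    simp only [algebraMap_int_eq, eq_intCast] at this
    simp only [affineVec, LinearMap.prod_apply, Int.cast_add, this, RootPairing.root',
      weylGroup_root_smul, T]
    rfl

variable [P.IsCrystallographic]

lemma affineVec_smul_add (w : AffineWeylGroup P) {a b c : ι × ℤ}
    (h : affineVec P c = affineVec P a + affineVec P b) :
    affineVec P (w • c) = affineVec P (w • a) + affineVec P (w • b) := by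
  obtain ⟨L, hL⟩ := exists_affineMap w
  rw [← hL, h, map_add, hL, hL]

lemma smul_affineNeg (w : AffineWeylGroup P) (a : ι × ℤ) :
    w • affineNeg P a = affineNeg P (w • a) := by
  obtain ⟨L, hL⟩ := exists_affineMap w
  apply affineVec_injective (P := P)
  rw [← hL, affineVec_neg, map_neg, hL, affineVec_neg]

lemma smul_shift (w : AffineWeylGroup P) (i : ι) (m k : ℤ) :
    w • ((i, m + k) : ι × ℤ) = ((w • ((i, m) : ι × ℤ)).1, (w • ((i, m) : ι × ℤ)).2 + k) := by
  simp only [smul_def]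
  ext
  · rfl
  · simp only; ring

lemma pairingIn_smul (x : P.weylGroup) (i j : ι) :
    P.pairingIn ℤ (x • i) (x • j) = P.pairingIn ℤ i j := by
  have h1 : weylOnV P x (P.coroot j) = P.coroot (x • j) := by
    simp only [weylOnV, MonoidHom.coe_mk, OneHom.coe_mk, RootPairing.Equiv.coweightEquiv_apply,
      RootPairing.Hom.coroot_coweightMap_apply]
    rfl
  have h2 := weylOnV_pairing P x i (P.coroot j)
  rw [h1, P.root'_coroot_eq_pairing, P.root'_coroot_eq_pairing] at h2
  apply FaithfulSMul.algebraMap_injective ℤ ℝ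
  rwa [RootPairing.algebraMap_pairingIn, RootPairing.algebraMap_pairingIn]

/-- An element of the affine Weyl group acting trivially on the affine roots is trivial. -/
lemma eq_one_of_forall_smul_eq [P.IsRootSystem] {w : AffineWeylGroup P}
    (h : ∀ a : ι × ℤ, w • a = a) : w = 1 := by
  have h1 : ∀ i, w.right • i = i := fun i => congrArg Prod.fst (h (i, 0))
  have h2 : ∀ i, P.root'In ℤ i w.left.toAdd = 0 := fun i => by
    have := congrArg Prod.snd (h (i, 0))
    simpa [smul_def, h1] using this
  apply SemidirectProduct.ext
  · change w.left.toAdd = 0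
    apply Subtype.ext
    change (w.left.toAdd : N) = 0
    rw [RootPairing.eq_zero_iff_forall_coroot'_eq_zero P.flip]
    intro i
    have := P.algebraMap_root'In_apply ℤ i w.left.toAdd
    rw [h2, map_zero] at this
    exact this.symm
  · apply Subtype.ext
    apply RootPairing.Equiv.weightHom_injective P
    rw [← LinearEquiv.toLinearMap_inj]
    refine LinearMap.ext_on_range (RootPairing.IsRootSystem.span_root_eq_top (P := P)) fun i => ?_
    have := weylGroup_root_smul w.right i
    rw [h1] at this
    exact this.symm.trans (by simp)

lemma eq_of_forall_smul_eq [P.IsRootSystem] {u w : AffineWeylGroup P}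
    (h : ∀ a : ι × ℤ, u • a = w • a) : u = w := by
  have := eq_one_of_forall_smul_eq (w := w⁻¹ * u) fun a => by rw [mul_smul, h, inv_smul_smul]
  rwa [inv_mul_eq_one, eq_comm] at this

variable (P) in
/-- The reflection in an affine root. -/
def affineRefl (a : ι × ℤ) : AffineWeylGroup P :=
  mulTranslation P (RootPairing.weylGroup.ofIdx P a.1) (-a.2 • P.corootSpanMem ℤ a.1)

lemma affineRefl_smul (a c : ι × ℤ) : affineRefl P a • c =
    (P.reflectionPerm a.1 c.1, c.2 - a.2 * P.pairingIn ℤ c.1 a.1) := by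
  obtain ⟨i, m⟩ := c
  rw [affineRefl, mulTranslation_smul, map_smul, RootPairing.root'In_corootSpanMem_eq_pairingIn]
  ext
  · rfl
  · simp only [smul_eq_mul]; ring

lemma affineVec_affineRefl_smul (a c : ι × ℤ) : affineVec P (affineRefl P a • c) =
    affineVec P c - (P.pairingIn ℤ c.1 a.1 : ℝ) • affineVec P a := by
  rw [affineRefl_smul]
  have := P.algebraMap_pairingIn ℤ c.1 a.1
  simp only [algebraMap_int_eq, eq_intCast] at this
  simp only [affineVec, Prod.smul_mk, Prod.mk_sub_mk, Prod.mk.injEq, Int.cast_sub, Int.cast_mul,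
    smul_eq_mul, P.root_reflectionPerm, P.reflection_apply_root, this]
  exact ⟨trivial, by ring⟩

lemma affineRefl_smul_self (a : ι × ℤ) : affineRefl P a • a = affineNeg P a := by
  apply affineVec_injective (P := P)
  rw [affineVec_affineRefl_smul, affineVec_neg, P.pairingIn_same]
  module

variable [P.IsRootSystem]

lemma affineRefl_mul_self (a : ι × ℤ) : affineRefl P a * affineRefl P a = 1 := by
  apply eq_one_of_forall_smul_eq
  intro c
  apply affineVec_injective (P := P)
  rw [mul_smul, affineVec_affineRefl_smul, affineVec_affineRefl_smul, affineRefl_smul]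
  have : P.pairingIn ℤ (P.reflectionPerm a.1 c.1) a.1 = - P.pairingIn ℤ c.1 a.1 := by
    rw [← P.pairingIn_reflectionPerm, P.pairingIn_reflectionPerm_self_right]
  simp only [this]
  push_cast
  module

lemma affineRefl_inv (a : ι × ℤ) : (affineRefl P a)⁻¹ = affineRefl P a :=
  inv_eq_of_mul_eq_one_right (affineRefl_mul_self a)

lemma affineRefl_smul_smul (a c : ι × ℤ) : affineRefl P a • affineRefl P a • c = c := by
  rw [← mul_smul, affineRefl_mul_self, one_smul]

lemma affineRefl_conj (u : AffineWeylGroup P) (a : ι × ℤ) :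
    u * affineRefl P a * u⁻¹ = affineRefl P (u • a) := by
  apply eq_of_forall_smul_eq
  intro c
  obtain ⟨L, hL⟩ := exists_affineMap u
  apply affineVec_injective (P := P)
  rw [mul_smul, mul_smul, ← hL, affineVec_affineRefl_smul, affineVec_affineRefl_smul, map_sub,
    map_smul, hL, hL, smul_inv_smul]
  have : P.pairingIn ℤ (u⁻¹ • c).1 a.1 = P.pairingIn ℤ c.1 (u • a).1 := by
    have := pairingIn_smul u.right (u⁻¹ • c).1 a.1
    rw [← this]
    change P.pairingIn ℤ (u • u⁻¹ • c).1 (u • a).1 = _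
    rw [smul_inv_smul]
  rw [this]

lemma affineRefl_neg (a : ι × ℤ) : affineRefl P (affineNeg P a) = affineRefl P a := by
  rw [← affineRefl_smul_self, ← affineRefl_conj, affineRefl_mul_self, one_mul, affineRefl_inv]

omit [P.IsCrystallographic] [P.IsRootSystem] in
/-- The affine Weyl group is generated by the affine reflections. -/
lemma closure_affineRefl : Subgroup.closure (Set.range (affineRefl P)) = ⊤ := by
  set K := Subgroup.closure (Set.range (affineRefl P)) with hK
  have hmem : ∀ a, affineRefl P a ∈ K := fun a => Subgroup.subset_closure ⟨a, rfl⟩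
  have hrefl : ∀ i, (SemidirectProduct.inr (RootPairing.weylGroup.ofIdx P i) :
      AffineWeylGroup P) ∈ K := fun i => by
    have := hmem (i, 0)
    simpa [affineRefl, mulTranslation] using this
  have hW : ∀ x : P.weylGroup, (SemidirectProduct.inr x : AffineWeylGroup P) ∈ K := by
    rintro ⟨x, hx⟩
    induction hx using RootPairing.weylGroup.induction with
    | mem i => exact hrefl i
    | one => exact one_mem K
    | mul x y hx hy h1 h2 =>
      have := mul_mem h1 h2
      rw [← map_mul] at this
      exact this
  have hT : ∀ l : P.corootSpan ℤ,
      (SemidirectProduct.inl (Multiplicative.ofAdd l) : AffineWeylGroup P) ∈ K := by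
    rintro ⟨l, hl⟩
    induction hl using Submodule.span_induction with
    | mem v hv =>
      obtain ⟨i, rfl⟩ := hv
      -- The reflections in `α` and `α - δ` differ by the translation by `α^∨`.
      have h1 := mul_mem (inv_mem (hrefl i)) (hmem (i, -1))
      simpa [affineRefl, mulTranslation] using h1
    | zero => exact one_mem K
    | add y z hy hz h1 h2 =>
      have := mul_mem h1 h2
      rw [← map_mul, ← ofAdd_add] at this
      exact this
    | smul n y hy h1 =>
      have := zpow_mem h1 n
      rw [← map_zpow, ← ofAdd_zsmul] at this
      exact this
  rw [eq_top_iff]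
  intro w _
  obtain ⟨p, hp, -⟩ := existsUnique_mulTranslation P w
  rw [hp]
  exact mul_mem (hW p.1) (hT p.2)

end AffineRoots

/-! ### The height of an affine root. -/

section AffineHeight

variable {ι M N : Type*} [Finite ι] [AddCommGroup M] [Module ℝ M] [AddCommGroup N] [Module ℝ N]
  {P : RootPairing ι ℝ M N} (b : P.Base)

lemma height_lt_coxeterNumber (i : ι) : b.height i < coxeterNumber b := by
  have : (b.height i).toNat ≤ sSup (Set.range fun i => (b.height i).toNat) :=
    le_csSup (Set.finite_range _).bddAbove ⟨i, rfl⟩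
  rw [coxeterNumber]
  lia

lemma neg_coxeterNumber_lt_height (i : ι) : -(coxeterNumber b : ℤ) < b.height i := by
  have := height_lt_coxeterNumber b (P.reflectionPerm i i)
  rw [height_neg] at this
  lia

lemma two_le_coxeterNumber [Nonempty ι] : 2 ≤ coxeterNumber b := by
  obtain ⟨s, hs⟩ := b.support_nonempty
  have h1 := RootPairing.Base.height_one_of_mem_support hs
  have h2 := height_lt_coxeterNumber b s
  lia

/-- The height of the affine root `α + m δ`, namely `h m - ht(α)`. -/
def affineHeight (a : ι × ℤ) : ℤ := coxeterNumber b * a.2 - b.height a.1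

omit [Finite ι] in
lemma affineHeight_neg (a : ι × ℤ) : affineHeight b (affineNeg P a) = - affineHeight b a := by
  simp only [affineHeight, affineNeg, height_neg]
  ring

omit [Finite ι] in
lemma affineHeight_shift (i : ι) (m k : ℤ) :
    affineHeight b (i, m + k) = affineHeight b (i, m) + coxeterNumber b * k := by
  simp only [affineHeight]; ring

/-- Since `ht(α) < h`, a positive multiple of `δ` always dominates the finite part. -/
lemma affineHeight_pos_of_pos {a : ι × ℤ} (h : 0 < a.2) : 0 < affineHeight b a := by
  have := height_lt_coxeterNumber b a.1
  simp only [affineHeight]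
  nlinarith

lemma affineHeight_ne_zero (a : ι × ℤ) : affineHeight b a ≠ 0 := by
  rcases lt_trichotomy a.2 0 with h | h | h
  · have := affineHeight_pos_of_pos b (a := affineNeg P a) (by simpa [affineNeg] using h)
    rw [affineHeight_neg] at this
    lia
  · simpa [affineHeight, h] using b.height_ne_zero a.1
  · exact (affineHeight_pos_of_pos b h).ne'

lemma nonneg_of_affineHeight_pos {a : ι × ℤ} (h : 0 < affineHeight b a) : 0 ≤ a.2 := by
  by_contra h'
  have := affineHeight_pos_of_pos b (a := affineNeg P a) (by simpa [affineNeg] using h')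
  rw [affineHeight_neg] at this
  lia

lemma isPosAffine_iff (a : ι × ℤ) : IsPosAffine b a ↔ 0 < affineHeight b a := by
  rw [IsPosAffine, isPos_neg_iff]
  constructor
  · rintro (⟨-, h⟩ | ⟨h1, h2⟩)
    · exact affineHeight_pos_of_pos b h
    · rcases h2.eq_or_lt with h | h
      · rw [RootPairing.Base.isPos_iff'] at h1
        simpa [affineHeight, ← h] using h1
      · exact affineHeight_pos_of_pos b h
  · intro h
    have h2 := nonneg_of_affineHeight_pos b h
    by_cases h1 : b.IsPos a.1
    · refine Or.inl ⟨h1, lt_of_le_of_ne h2 fun h3 => ?_⟩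
      rw [RootPairing.Base.isPos_iff] at h1
      simp [affineHeight, ← h3] at h
      lia
    · exact Or.inr ⟨h1, h2⟩

variable [P.IsCrystallographic] [P.IsRootSystem]

/-- The height seen from the alcove of `w⁻¹` is still linear. With `affineHeight_ne_zero`, this
replaces case analysis on signs of roots by integer inequalities. -/
lemma exists_affineHeightFunctional (w : AffineWeylGroup P) :
    ∃ f : M × ℝ →ₗ[ℝ] ℝ, ∀ a, f (affineVec P a) = affineHeight b (w • a) := by
  obtain ⟨g, hg⟩ := exists_heightFunctional b
  obtain ⟨L, hL⟩ := exists_affineMap w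
  refine ⟨((coxeterNumber b : ℝ) • LinearMap.snd ℝ M ℝ - g ∘ₗ LinearMap.fst ℝ M ℝ) ∘ₗ L, fun a => ?_⟩
  rw [LinearMap.comp_apply, hL]
  simp [affineVec, affineHeight, hg]

lemma affineHeight_smul_add (w : AffineWeylGroup P) {a c d : ι × ℤ}
    (h : affineVec P c = affineVec P a + affineVec P d) :
    affineHeight b (w • c) = affineHeight b (w • a) + affineHeight b (w • d) := by
  obtain ⟨f, hf⟩ := exists_affineHeightFunctional b w
  have := congrArg f h
  rw [map_add, hf, hf, hf] at this
  exact_mod_cast this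

lemma affineHeight_add {a c d : ι × ℤ} (h : affineVec P c = affineVec P a + affineVec P d) :
    affineHeight b c = affineHeight b a + affineHeight b d := by
  simpa using affineHeight_smul_add b 1 h

omit [Finite ι] [P.IsRootSystem] in
lemma affineHeight_smul_neg (w : AffineWeylGroup P) (a : ι × ℤ) :
    affineHeight b (w • affineNeg P a) = - affineHeight b (w • a) := by
  rw [smul_affineNeg, affineHeight_neg]

omit [Finite ι] [P.IsRootSystem] in
lemma affineHeight_smul_shift (w : AffineWeylGroup P) (i : ι) (m k : ℤ) :
    affineHeight b (w • ((i, m + k) : ι × ℤ)) =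
      affineHeight b (w • ((i, m) : ι × ℤ)) + coxeterNumber b * k := by
  rw [smul_shift, affineHeight_shift]

lemma affineHeight_affineRefl (a c : ι × ℤ) :
    affineHeight b (affineRefl P a • c) =
      affineHeight b c - P.pairingIn ℤ c.1 a.1 * affineHeight b a := by
  obtain ⟨f, hf⟩ := exists_affineHeightFunctional b 1
  have := congrArg f (affineVec_affineRefl_smul (P := P) a c)
  rw [map_sub, map_smul, hf, hf, hf, one_smul, one_smul, one_smul, smul_eq_mul] at this
  exact_mod_cast this

/-- The reflection in an affine root of height one permutes the other positive affine roots. -/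
lemma affineHeight_affineRefl_pos [P.IsReduced] {a c : ι × ℤ} (ha : affineHeight b a = 1)
    (hc : 0 < affineHeight b c) (hne : c ≠ a) : 0 < affineHeight b (affineRefl P a • c) := by
  have : Nonempty ι := ⟨a.1⟩
  have h2 := two_le_coxeterNumber b
  rw [affineHeight_affineRefl, ha, mul_one]
  by_cases hle : P.pairingIn ℤ c.1 a.1 ≤ 0
  · lia
  push Not at hle
  -- Here `c = a + k δ` with `k ≥ 1`, and the reflected height is `h k - 1`.
  by_cases hi : c.1 = a.1
  · obtain ⟨i, m⟩ := a
    obtain ⟨j, n⟩ := c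
    change j = i at hi
    subst hi
    change 0 < affineHeight b (j, n) - P.pairingIn ℤ j j
    rw [P.pairingIn_same]
    have hn : n ≠ m := fun h => hne (by rw [h])
    have h3 := affineHeight_shift b j m (n - m)
    rw [add_sub_cancel, ha] at h3
    have : 1 ≤ n - m := by
      by_contra hlt
      have : n - m ≤ -1 := by lia
      nlinarith
    nlinarith
  · by_contra hcon
    have hind : LinearIndependent ℝ ![P.root a.1, P.root c.1] := by
      refine RootPairing.IsReduced.linearIndependent P (Ne.symm hi) fun h => ?_
      have h3 : a.1 = P.reflectionPerm c.1 c.1 := P.root.injective (by rw [root_neg, h])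
      rw [h3, P.pairingIn_reflectionPerm_self_right, P.pairingIn_same] at hle
      lia
    -- A nonpositive reflected height means that the height `k` of `c` is at most `⟨c, a^∨⟩`, hence
    -- at most the length of the `a`-chain below `c`. Then `c - k a` is an affine root of height
    -- zero, which is impossible.
    have hch := P.chainBotCoeff_sub_chainTopCoeff hind
    obtain ⟨k, hk⟩ := Int.eq_ofNat_of_zero_le hc.le
    have hk' : k ≤ P.chainBotCoeff a.1 c.1 := by
      lia
    obtain ⟨r, hr⟩ := (P.root_sub_nsmul_mem_range_iff_le_chainBotCoeff hind).2 hk'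
    obtain ⟨f, hf⟩ := exists_affineHeightFunctional b 1
    have hv : affineVec P (r, c.2 - k * a.2) = affineVec P c - (k : ℝ) • affineVec P a := by
      simp [affineVec, hr, Nat.cast_smul_eq_nsmul]
    have := congrArg f hv
    rw [map_sub, map_smul, hf, hf, hf, one_smul, one_smul, one_smul, ha, hk] at this
    apply affineHeight_ne_zero b (r, c.2 - k * a.2)
    simp at this
    exact_mod_cast this

end AffineHeight

/-! ### Affine roots of height one and decompositions of the others. -/

section Decomposition

variable {ι M N : Type*} [Finite ι] [AddCommGroup M] [Module ℝ M] [AddCommGroup N] [Module ℝ N]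
  {P : RootPairing ι ℝ M N} [P.IsCrystallographic] (b : P.Base)

lemma IsHighestRoot.height_lt {b : P.Base} {t i : ι} [P.IsRootSystem] (ht : IsHighestRoot b t)
    (hi : i ≠ t) : b.height i < b.height t := by
  obtain ⟨f, hf⟩ := exists_heightFunctional b
  have key : ∀ x ∈ AddSubmonoid.closure (P.root '' {k | b.IsPos k}), x = 0 ∨ 0 < f x := by
    intro x hx
    induction hx using AddSubmonoid.closure_induction with
    | mem x hx =>
      obtain ⟨k, hk, rfl⟩ := hx
      rw [hf]
      exact Or.inr (by exact_mod_cast hk)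
    | zero => exact Or.inl rfl
    | add x y _ _ hx hy =>
      rcases hx with rfl | hx <;> rcases hy with rfl | hy
      · simp
      · simp [hy]
      · simp [hx]
      · rw [map_add]; exact Or.inr (add_pos hx hy)
  rcases key _ (ht.2 i hi).2 with h | h
  · exact absurd (P.root.injective (sub_eq_zero.1 h)).symm hi
  · rw [map_sub, hf, hf, sub_pos] at h
    exact_mod_cast h

lemma IsHighestRoot.coxeterNumber_eq {b : P.Base} [P.IsRootSystem] {t : ι}
    (ht : IsHighestRoot b t) : (coxeterNumber b : ℤ) = 1 + b.height t := by
  have h1 : ∀ i, b.height i ≤ b.height t := fun i => by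
    by_cases hi : i = t
    · rw [hi]
    · exact (ht.height_lt hi).le
  have : sSup (Set.range fun i => (b.height i).toNat) = (b.height t).toNat := by
    apply IsGreatest.csSup_eq
    refine ⟨⟨t, rfl⟩, ?_⟩
    rintro _ ⟨i, rfl⟩
    have := h1 i
    simp only
    lia
  have h2 := ht.1
  rw [RootPairing.Base.isPos_iff] at h2
  rw [coxeterNumber, this]
  lia

lemma IsHighestRoot.affineHeight_eq {b : P.Base} [P.IsRootSystem] {t : ι}
    (ht : IsHighestRoot b t) : affineHeight b (t, 1) = 1 := by
  simp [affineHeight, ht.coxeterNumber_eq]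

omit [Finite ι] [P.IsCrystallographic] in
lemma affineHeight_neg_simple {b : P.Base} {j : ι} (hj : j ∈ b.support) :
    affineHeight b (P.reflectionPerm j j, 0) = 1 := by
  simp only [affineHeight, height_neg, RootPairing.Base.height_one_of_mem_support hj]
  lia

/-- The reflections in the affine roots of height one are simple reflections. -/
lemma affineRefl_mem_simpleReflections [P.IsRootSystem] [P.IsIrreducible] [P.IsReduced]
    {a : ι × ℤ} (ha : affineHeight b a = 1) : affineRefl P a ∈ simpleReflections b := by
  obtain ⟨t, ht⟩ := exists_isHighestRoot b
  have hh := ht.coxeterNumber_eq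
  have h0 := nonneg_of_affineHeight_pos b (a := a) (by lia)
  obtain ⟨i, m⟩ := a
  simp only [affineHeight] at ha h0
  have hlt := neg_coxeterNumber_lt_height b i
  have hlt' := height_lt_coxeterNumber b i
  have hc : (0 : ℤ) < coxeterNumber b := by lia
  have hm : m < 2 := by
    by_contra h
    nlinarith
  interval_cases m
  · left
    have hi : b.height (P.reflectionPerm i i) = 1 := by rw [height_neg]; lia
    refine ⟨P.reflectionPerm i i, ?_, ?_⟩
    · have hpos : b.IsPos (P.reflectionPerm i i) := by
        rw [RootPairing.Base.isPos_iff]; lia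
      -- A root of height one is simple: it pairs positively with a simple root, and if it were a
      -- different one their difference would be a root of height zero.
      obtain ⟨j, hj, hj'⟩ := hpos.exists_mem_support_pos_pairingIn
      by_cases hij : P.reflectionPerm i i = j
      · rwa [hij]
      · obtain ⟨r, hr⟩ := P.root_sub_root_mem_of_pairingIn_pos hj' (Ne.symm hij)
        have := b.height_sub hr
        rw [RootPairing.Base.height_one_of_mem_support hj, hi] at this
        exact absurd this (b.height_ne_zero r)
    · have := affineRefl_neg (P := P) (i, 0)
      rw [← this]
      simp [affineRefl, affineNeg]
  · right
    refine ⟨t, ht, ?_⟩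
    have : i = t := by
      by_contra h
      have := ht.height_lt h
      lia
    simp [affineRefl, this]

lemma exists_of_mem_simpleReflections [P.IsRootSystem] {s : AffineWeylGroup P}
    (hs : s ∈ simpleReflections b) : ∃ a, affineHeight b a = 1 ∧ s = affineRefl P a := by
  rcases hs with ⟨i, hi, rfl⟩ | ⟨t, ht, rfl⟩
  · refine ⟨(P.reflectionPerm i i, 0), affineHeight_neg_simple hi, ?_⟩
    have := affineRefl_neg (P := P) (i, 0)
    rw [affineNeg, neg_zero] at this
    rw [this]
    simp [affineRefl]
  · exact ⟨(t, 1), ht.affineHeight_eq, by simp [affineRefl]⟩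

/-- Every affine root makes an acute angle with some affine root of height one. -/
lemma exists_pairingIn_pos [P.IsRootSystem] [P.IsIrreducible] [P.IsReduced] (i : ι) :
    ∃ a, affineHeight b a = 1 ∧ 0 < P.pairingIn ℤ i a.1 := by
  by_cases h : ∀ j ∈ b.support, 0 ≤ P.pairingIn ℤ i j
  · obtain ⟨t, ht⟩ := exists_isHighestRoot b
    refine ⟨(t, 1), ht.affineHeight_eq, ?_⟩
    rw [P.zero_lt_pairingIn_iff']
    by_cases hit : i = t
    · simp [hit]
    -- For dominant `i`, the functional `⟨·, i^∨⟩` is nonnegative on positive roots, hence on `θ -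
    -- i`, so `⟨θ, i^∨⟩ ≥ 2`.
    have hpos : ∀ k, b.IsPos k → 0 ≤ P.pairingIn ℤ k i := by
      intro k hk
      obtain ⟨f, hf, -, hk⟩ := root_nonneg_coeff b hk
      rw [pairingIn_sum b hk]
      exact Finset.sum_nonneg fun j hj => mul_nonneg (hf j) (pairingIn_nonneg_symm (h j hj))
    have hcl : ∀ x ∈ AddSubmonoid.closure (P.root '' {k | b.IsPos k}), 0 ≤ P.coroot' i x := by
      intro x hx
      induction hx using AddSubmonoid.closure_induction with
      | mem x hx =>
        obtain ⟨k, hk, rfl⟩ := hx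
        rw [P.root_coroot'_eq_pairing, ← P.algebraMap_pairingIn ℤ]
        simpa using hpos k hk
      | zero => simp
      | add x y _ _ hx hy => rw [map_add]; exact add_nonneg hx hy
    have := hcl _ (ht.2 i hit).2
    rw [map_sub, P.root_coroot'_eq_pairing, P.root_coroot'_eq_pairing, P.pairing_same,
      ← P.algebraMap_pairingIn ℤ] at this
    have h3 : (2 : ℝ) ≤ (P.pairingIn ℤ t i : ℤ) := by simpa using this
    have h4 : (2 : ℤ) ≤ P.pairingIn ℤ t i := by exact_mod_cast h3
    lia
  · push Not at h
    obtain ⟨j, hj, hlt⟩ := h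
    refine ⟨(P.reflectionPerm j j, 0), affineHeight_neg_simple hj, ?_⟩
    simpa using hlt

/-- A positive affine root of height at least two is a sum of two positive affine roots, one of
which may be the imaginary root `δ`. -/
lemma exists_decomposition [P.IsRootSystem] [P.IsIrreducible] [P.IsReduced] {a : ι × ℤ}
    (ha : 2 ≤ affineHeight b a) :
    (∃ c d, affineVec P a = affineVec P c + affineVec P d ∧
      0 < affineHeight b c ∧ 0 < affineHeight b d) ∨ 0 < affineHeight b (a.1, a.2 - 1) := by
  obtain ⟨c, hc, hpos⟩ := exists_pairingIn_pos b a.1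
  obtain ⟨i, m⟩ := a
  obtain ⟨j, n⟩ := c
  -- A height one root `c` at an acute angle to `a` is subtracted. If the finite parts agree, `a -
  -- c` is a positive multiple of `δ`, and `a - δ` still has height at least that of `c`.
  by_cases hij : i = j
  · right
    subst hij
    have h1 := affineHeight_shift b i n (m - n)
    have h2 := affineHeight_shift b i n (m - n - 1)
    rw [add_sub_cancel] at h1
    rw [show n + (m - n - 1) = m - 1 by ring] at h2
    have : 1 ≤ m - n := by
      by_contra hlt
      have : m - n ≤ 0 := by lia
      have : (coxeterNumber b : ℤ) * (m - n) ≤ 0 :=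
        mul_nonpos_of_nonneg_of_nonpos (by lia) this
      lia
    have : 0 ≤ (coxeterNumber b : ℤ) * (m - n - 1) := mul_nonneg (by lia) (by lia)
    simp only
    lia
  · left
    obtain ⟨r, hr⟩ := P.root_sub_root_mem_of_pairingIn_pos hpos hij
    have hv : affineVec P (i, m) = affineVec P (j, n) + affineVec P (r, m - n) := by
      rw [affineVec_eq_add_iff]
      simp only [hr]
      exact ⟨by abel, by ring⟩
    refine ⟨_, _, hv, by lia, ?_⟩
    have := affineHeight_add b hv
    lia

end Decomposition

/-! ### Inversion sets, length, and biconvex sets. -/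

section Inversions

variable {ι M N : Type*} [Finite ι] [AddCommGroup M] [Module ℝ M] [AddCommGroup N] [Module ℝ N]
  {P : RootPairing ι ℝ M N} [P.IsCrystallographic] (b : P.Base)

lemma mem_inversionSet_iff {w : AffineWeylGroup P} {a : ι × ℤ} :
    a ∈ inversionSet b w ↔ 0 < affineHeight b a ∧ affineHeight b (w⁻¹ • a) < 0 := by
  have := affineHeight_ne_zero b (w⁻¹ • a)
  simp only [inversionSet, Set.mem_ofPred_eq, isPosAffine_iff]
  lia

lemma inversionSet_one : inversionSet b (1 : AffineWeylGroup P) = ∅ := by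
  ext a
  simp only [mem_inversionSet_iff, inv_one, one_smul, Set.mem_empty_iff_false, iff_false]
  lia

variable [P.IsRootSystem]

/-- A nonempty coclosed set of positive affine roots contains a root of height one. -/
lemma exists_height_one_mem [P.IsIrreducible] [P.IsReduced] {S : Set (ι × ℤ)}
    (hpos : ∀ a ∈ S, 0 < affineHeight b a)
    (hadd : ∀ a ∉ S, 0 < affineHeight b a → ∀ c ∉ S, 0 < affineHeight b c →
      ∀ d, affineVec P d = affineVec P a + affineVec P c → d ∉ S)
    (hshift : ∀ i m, (i, m) ∉ S → 0 < affineHeight b (i, m) → (i, m + 1) ∉ S)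
    (h : S.Nonempty) : ∃ a ∈ S, affineHeight b a = 1 := by
  obtain ⟨a₀, ha₀⟩ := h
  suffices ∀ n : ℕ, ∀ a ∈ S, affineHeight b a = n → ∃ a ∈ S, affineHeight b a = 1 by
    have h1 := hpos a₀ ha₀
    exact this (affineHeight b a₀).toNat a₀ ha₀ (by lia)
  intro n
  induction n using Nat.strong_induction_on with
  | _ n ih =>
    intro a ha han
    by_cases h1 : affineHeight b a = 1
    · exact ⟨a, ha, h1⟩
    have hapos := hpos a ha
    have : Nonempty ι := ⟨a.1⟩
    have := two_le_coxeterNumber b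
    -- By coclosedness, one summand of `a` (or `a - δ`) is again in `S`, and it has smaller height.
    rcases exists_decomposition b (a := a) (by lia) with ⟨c, d, hv, hc, hd⟩ | hd
    · have e1 := affineHeight_add b hv
      by_cases hcS : c ∈ S
      · exact ih (affineHeight b c).toNat (by lia) c hcS (by lia)
      by_cases hdS : d ∈ S
      · exact ih (affineHeight b d).toNat (by lia) d hdS (by lia)
      · exact absurd ha (hadd c hcS hc d hdS hd a hv)
    · have e1 := affineHeight_shift b a.1 (a.2 - 1) 1
      rw [sub_add_cancel] at e1
      change affineHeight b a = _ at e1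
      by_cases hdS : (a.1, a.2 - 1) ∈ S
      · exact ih (affineHeight b (a.1, a.2 - 1)).toNat (by lia) _ hdS (by lia)
      · have := hshift a.1 (a.2 - 1) hdS hd
        rw [sub_add_cancel] at this
        exact absurd ha this

lemma exists_height_one_mem_inversionSet [P.IsIrreducible] [P.IsReduced] {w : AffineWeylGroup P}
    (h : (inversionSet b w).Nonempty) : ∃ a ∈ inversionSet b w, affineHeight b a = 1 := by
  have hnot : ∀ a ∉ inversionSet b w, 0 < affineHeight b a → 0 < affineHeight b (w⁻¹ • a) := by
    intro a h1 h2
    have := affineHeight_ne_zero b (w⁻¹ • a)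
    rw [mem_inversionSet_iff] at h1
    lia
  refine exists_height_one_mem b (fun a ha => ((mem_inversionSet_iff b).1 ha).1) ?_ ?_ h
  · intro a ha ha0 c hc hc0 d hd hdS
    have h1 := affineHeight_smul_add b w⁻¹ hd
    have h2 := hnot a ha ha0
    have h3 := hnot c hc hc0
    rw [mem_inversionSet_iff] at hdS
    lia
  · intro i m h1 h2 h3
    have h4 := hnot _ h1 h2
    rw [mem_inversionSet_iff, affineHeight_smul_shift] at h3
    lia

variable [P.IsReduced]

/-- If `a` is an inversion of `w` of height one, the inversions of `s_a w` are the images under `s_a` of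
the other inversions of `w`. -/
lemma inversionSet_affineRefl_mul {a : ι × ℤ} (ha : affineHeight b a = 1) {w : AffineWeylGroup P}
    (haw : a ∈ inversionSet b w) : inversionSet b (affineRefl P a * w) =
      (fun c => affineRefl P a • c) '' (inversionSet b w \ {a}) := by
  rw [mem_inversionSet_iff] at haw
  ext c
  simp only [mem_inversionSet_iff, mul_inv_rev, affineRefl_inv, mul_smul, Set.mem_image,
    Set.mem_sdiff, Set.mem_singleton_iff]
  constructor
  · rintro ⟨h1, h2⟩
    have hca : c ≠ a := by
      rintro rfl
      rw [affineRefl_smul_self, affineHeight_smul_neg] at h2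
      lia
    refine ⟨affineRefl P a • c, ⟨⟨affineHeight_affineRefl_pos b ha h1 hca, h2⟩, fun h => ?_⟩,
      affineRefl_smul_smul (P := P) a c⟩
    have : c = affineNeg P a := by
      rw [← affineRefl_smul_smul (P := P) a c, h, affineRefl_smul_self]
    rw [this, affineHeight_neg] at h1
    lia
  · rintro ⟨d, ⟨⟨h1, h2⟩, h3⟩, rfl⟩
    rw [affineRefl_smul_smul]
    exact ⟨affineHeight_affineRefl_pos b ha h1 h3, h2⟩

omit [P.IsReduced] in
lemma mem_inversionSet_affineRefl_mul {a : ι × ℤ} (ha : affineHeight b a = 1)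
    {w : AffineWeylGroup P} (haw : a ∉ inversionSet b w) :
    a ∈ inversionSet b (affineRefl P a * w) := by
  have := affineHeight_ne_zero b (w⁻¹ • a)
  rw [mem_inversionSet_iff] at haw ⊢
  rw [mul_inv_rev, affineRefl_inv, mul_smul, affineRefl_smul_self, affineHeight_smul_neg]
  lia

lemma inversionSet_eq_image {a : ι × ℤ} (ha : affineHeight b a = 1)
    {w : AffineWeylGroup P} (haw : a ∉ inversionSet b w) : inversionSet b w =
      (fun c => affineRefl P a • c) '' (inversionSet b (affineRefl P a * w) \ {a}) := by
  have := inversionSet_affineRefl_mul b ha (mem_inversionSet_affineRefl_mul b ha haw)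
  rwa [← mul_assoc, affineRefl_mul_self, one_mul] at this

omit [Finite ι] [P.IsRootSystem] [P.IsReduced] in
lemma affineRefl_smul_injective (a : ι × ℤ) :
    Function.Injective (fun c : ι × ℤ => affineRefl P a • c) := MulAction.injective _

lemma ncard_inversionSet_affineRefl_mul_le {a : ι × ℤ} (ha : affineHeight b a = 1)
    {w : AffineWeylGroup P} (hfin : (inversionSet b w).Finite) :
    (inversionSet b (affineRefl P a * w)).Finite ∧
      (inversionSet b (affineRefl P a * w)).ncard ≤ (inversionSet b w).ncard + 1 := by
  by_cases haw : a ∈ inversionSet b w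
  · rw [inversionSet_affineRefl_mul b ha haw, Set.ncard_image_of_injective _
      (affineRefl_smul_injective a)]
    exact ⟨(hfin.sdiff).image _, (Set.ncard_sdiff_singleton_le _ _).trans (Nat.le_succ _)⟩
  · have h1 := mem_inversionSet_affineRefl_mul b ha haw
    have h2 := inversionSet_eq_image b ha haw
    have hfin' : (inversionSet b (affineRefl P a * w)).Finite := by
      rw [h2] at hfin
      have := (Set.finite_image_iff (affineRefl_smul_injective a).injOn).1 hfin
      exact (this.union (Set.finite_singleton a)).subset (by simp)
    refine ⟨hfin', ?_⟩
    rw [h2, Set.ncard_image_of_injective _ (affineRefl_smul_injective a),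
      Set.ncard_sdiff_singleton_add_one h1 hfin']

variable [P.IsIrreducible]

/-- The affine Weyl group is generated by the simple reflections. -/
lemma closure_simpleReflections :
    Subgroup.closure (simpleReflections b) = (⊤ : Subgroup (AffineWeylGroup P)) := by
  rw [← closure_affineRefl]
  set K := Subgroup.closure (simpleReflections b) with hK
  have hS : ∀ {a}, affineHeight b a = 1 → affineRefl P a ∈ K := fun ha =>
    Subgroup.subset_closure (affineRefl_mem_simpleReflections b ha)
  have hpos : ∀ n : ℕ, ∀ a, affineHeight b a = n → 0 < affineHeight b a → affineRefl P a ∈ K := by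
    intro n
    induction n using Nat.strong_induction_on with
    | _ n ih =>
      intro a han ha
      -- Reflecting `a` in an acute height one root lowers its height while keeping it positive, and
      -- conjugates its reflection by a simple one.
      obtain ⟨c, hc, hac⟩ := exists_pairingIn_pos b a.1
      by_cases hca : a = c
      · rw [hca]; exact hS hc
      have h1 := affineHeight_affineRefl_pos b hc ha hca
      have h2 := affineHeight_affineRefl b c a
      rw [hc, mul_one] at h2
      have h3 := ih (affineHeight b (affineRefl P c • a)).toNat (by lia) (affineRefl P c • a)
        (by lia) h1
      rw [← affineRefl_conj] at h3
      have h4 := mul_mem (mul_mem (inv_mem (hS hc)) h3) (hS hc)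
      simpa [mul_assoc] using h4
  apply le_antisymm
  · rw [Subgroup.closure_le]
    intro s hs
    obtain ⟨a, -, rfl⟩ := exists_of_mem_simpleReflections b hs
    exact Subgroup.subset_closure ⟨a, rfl⟩
  · rw [Subgroup.closure_le]
    rintro _ ⟨a, rfl⟩
    rcases lt_or_gt_of_ne (affineHeight_ne_zero b a) with h | h
    · rw [← affineRefl_neg]
      have := affineHeight_neg b a
      exact hpos (affineHeight b (affineNeg P a)).toNat _ (by lia) (by lia)
    · exact hpos (affineHeight b a).toNat _ (by lia) h

lemma exists_word (w : AffineWeylGroup P) : ∃ L : List (AffineWeylGroup P),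
    (∀ s ∈ L, s ∈ simpleReflections b) ∧ L.prod = w := by
  have hw : w ∈ Subgroup.closure (simpleReflections b) := by
    rw [closure_simpleReflections]; trivial
  rw [← Subgroup.mem_toSubmonoid, Subgroup.closure_toSubmonoid] at hw
  obtain ⟨L, hL, hw⟩ := Submonoid.exists_list_of_mem_closure hw
  refine ⟨L, fun s hs => ?_, hw⟩
  rcases hL s hs with h | h
  · exact h
  · obtain ⟨a, ha, h'⟩ := exists_of_mem_simpleReflections b h
    rw [inv_eq_iff_eq_inv, affineRefl_inv] at h'
    rw [h']
    exact affineRefl_mem_simpleReflections b ha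

omit [P.IsIrreducible] in
/-- The exchange condition. -/
lemma exists_word_mul_affineRefl (L : List (AffineWeylGroup P))
    (hL : ∀ s ∈ L, s ∈ simpleReflections b) {a : ι × ℤ} (ha : affineHeight b a = 1)
    (hneg : affineHeight b (L.prod • a) < 0) : ∃ L' : List (AffineWeylGroup P),
      (∀ s ∈ L', s ∈ simpleReflections b) ∧ L'.length + 1 = L.length ∧
        L'.prod = L.prod * affineRefl P a := by
  induction L with
  | nil => simp at hneg; lia
  | cons s T ih =>
    rw [List.forall_mem_cons] at hL
    by_cases hT : affineHeight b (T.prod • a) < 0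
    · obtain ⟨L', h1, h2, h3⟩ := ih hL.2 hT
      refine ⟨s :: L', by simpa using ⟨hL.1, h1⟩, by simp [h2], by simp [h3, mul_assoc]⟩
    · refine ⟨T, hL.2, by simp, ?_⟩
      obtain ⟨c, hc, rfl⟩ := exists_of_mem_simpleReflections b hL.1
      have h0 := affineHeight_ne_zero b (T.prod • a)
      -- The only positive root that `s_c` makes negative is `c`. Conjugation then gives `s_c T = T
      -- s_a`, so the letter `s_c` can be deleted.
      have : T.prod • a = c := by
        by_contra hne
        have := affineHeight_affineRefl_pos b hc (by lia) hne
        rw [List.prod_cons, mul_smul] at hneg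
        lia
      rw [List.prod_cons, ← this, ← affineRefl_conj, mul_assoc _ (T.prod)⁻¹, inv_mul_cancel,
        mul_one, mul_assoc, affineRefl_mul_self, mul_one]

/-- An element of the affine Weyl group without inversions is trivial. -/
lemma eq_one_of_inversionSet_eq_empty {w : AffineWeylGroup P} (h : inversionSet b w = ∅) :
    w = 1 := by
  obtain ⟨L, hL, hw⟩ := exists_word b w
  generalize hn : L.length = n
  induction n using Nat.strong_induction_on generalizing L with
  | _ n ih =>
    rcases L.eq_nil_or_concat' with rfl | ⟨T, s, rfl⟩
    · simpa using hw.symm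
    have hT : ∀ s ∈ T, s ∈ simpleReflections b := fun u hu => hL u (by simp [hu])
    obtain ⟨a, ha, hs⟩ := exists_of_mem_simpleReflections b (hL s (by simp))
    have hwa : ∀ c, 0 < affineHeight b c → 0 < affineHeight b (w⁻¹ • c) := fun c hc => by
      have h1 : c ∉ inversionSet b w := by simp [h]
      rw [mem_inversionSet_iff] at h1
      have := affineHeight_ne_zero b (w⁻¹ • c)
      lia
    have hwa' : 0 < affineHeight b (w • a) := by
      by_contra hcon
      have h0 := affineHeight_ne_zero b (w • a)
      have h1 := affineHeight_neg b (w • a)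
      have h2 := hwa (affineNeg P (w • a)) (by lia)
      rw [affineHeight_smul_neg, inv_smul_smul] at h2
      lia
    have hprod : T.prod = w * affineRefl P a := by
      rw [← hw, List.prod_append, List.prod_singleton, hs, mul_assoc, affineRefl_mul_self, mul_one]
    -- As `w` preserves positivity, `T = w s_a` sends `a` to a negative root. The exchange condition
    -- shortens `T` to a word for `T s_a = w`, two letters shorter than the original one.
    obtain ⟨L', h1, h2, h3⟩ := exists_word_mul_affineRefl b T hT ha (by
      rw [hprod, mul_smul, affineRefl_smul_self, affineHeight_smul_neg]
      lia)
    refine ih L'.length ?_ L' h1 ?_ rfl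
    · rw [← hn, List.length_append, List.length_singleton]; lia
    · rw [h3, hprod, mul_assoc, affineRefl_mul_self, mul_one]

omit [P.IsIrreducible] in
-- Each letter adds at most one inversion. This is the lower bound for the length, and also the
-- source of finiteness.
lemma inversionSet_prod (L : List (AffineWeylGroup P)) (hL : ∀ s ∈ L, s ∈ simpleReflections b) :
    (inversionSet b L.prod).Finite ∧ (inversionSet b L.prod).ncard ≤ L.length := by
  induction L with
  | nil => simp [inversionSet_one]
  | cons s T ih =>
    rw [List.forall_mem_cons] at hL
    obtain ⟨a, ha, rfl⟩ := exists_of_mem_simpleReflections b hL.1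
    obtain ⟨h1, h2⟩ := ih hL.2
    obtain ⟨h3, h4⟩ := ncard_inversionSet_affineRefl_mul_le b ha h1
    rw [List.prod_cons, List.length_cons]
    exact ⟨h3, by lia⟩

lemma finite_inversionSet (w : AffineWeylGroup P) : (inversionSet b w).Finite := by
  obtain ⟨L, hL, rfl⟩ := exists_word b w
  exact (inversionSet_prod b L hL).1

/-- The upper bound for the length: multiplying by the reflection in an inversion of height one
removes exactly one inversion. -/
lemma exists_word_length_eq_ncard (w : AffineWeylGroup P) : ∃ L : List (AffineWeylGroup P),
    (∀ s ∈ L, s ∈ simpleReflections b) ∧ L.prod = w ∧ L.length = (inversionSet b w).ncard := by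
  generalize hn : (inversionSet b w).ncard = n
  induction n generalizing w with
  | zero =>
    rw [Set.ncard_eq_zero (finite_inversionSet b w)] at hn
    exact ⟨[], by simp, by simp [eq_one_of_inversionSet_eq_empty b hn], rfl⟩
  | succ n ih =>
    obtain ⟨a, haw, ha⟩ := exists_height_one_mem_inversionSet b (w := w)
      (Set.nonempty_of_ncard_ne_zero (by lia))
    obtain ⟨L, h1, h2, h3⟩ := ih (affineRefl P a * w) (by
      rw [inversionSet_affineRefl_mul b ha haw, Set.ncard_image_of_injective _
        (affineRefl_smul_injective a), Set.ncard_sdiff_singleton_of_mem haw, hn, Nat.add_sub_cancel])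
    refine ⟨affineRefl P a :: L, ?_, ?_, by simp [h3]⟩
    · simpa using ⟨affineRefl_mem_simpleReflections b ha, h1⟩
    · rw [List.prod_cons, h2, ← mul_assoc, affineRefl_mul_self, one_mul]

/-- The length of `w` is the number of its inversions. -/
lemma length_eq_ncard_inversionSet (w : AffineWeylGroup P) :
    length b w = (inversionSet b w).ncard := by
  obtain ⟨L, h1, h2, h3⟩ := exists_word_length_eq_ncard b w
  apply le_antisymm
  · exact Nat.sInf_le ⟨L, h1, h2, h3⟩
  · refine le_csInf ⟨_, L, h1, h2, h3⟩ ?_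
    rintro n ⟨L', h1', rfl, rfl⟩
    exact (inversionSet_prod b L' h1').2

/-- An element of the affine Weyl group is determined by its inversions. -/
lemma inversionSet_injective : Function.Injective (inversionSet b (P := P)) := by
  intro u w h
  have : u⁻¹ * w = 1 := by
    apply eq_one_of_inversionSet_eq_empty b
    ext a
    simp only [mem_inversionSet_iff, Set.mem_empty_iff_false, iff_false, mul_inv_rev, inv_inv,
      mul_smul]
    rintro ⟨h1, h2⟩
    have h0 := affineHeight_ne_zero b (u • a)
    rcases lt_or_gt_of_ne h0 with h3 | h3
    · have h4 : affineNeg P (u • a) ∈ inversionSet b u := by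
        rw [mem_inversionSet_iff, affineHeight_neg, affineHeight_smul_neg, inv_smul_smul]
        lia
      rw [h, mem_inversionSet_iff, affineHeight_smul_neg] at h4
      lia
    · have h4 : u • a ∈ inversionSet b w := by
        rw [mem_inversionSet_iff]
        exact ⟨h3, h2⟩
      rw [← h, mem_inversionSet_iff, inv_smul_smul] at h4
      lia
  rwa [inv_mul_eq_one] at this

/-- Biconvex sets of positive affine roots. The last two conditions express that `N` is closed and
coclosed under sums involving the imaginary roots, and contains none of them. -/
structure IsBiconvex (S : Set (ι × ℤ)) : Prop where
  pos : ∀ a ∈ S, 0 < affineHeight b a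
  add_mem : ∀ a ∈ S, ∀ c ∈ S, ∀ d, affineVec P d = affineVec P a + affineVec P c → d ∈ S
  add_notMem : ∀ a ∉ S, 0 < affineHeight b a → ∀ c ∉ S, 0 < affineHeight b c →
    ∀ d, affineVec P d = affineVec P a + affineVec P c → d ∉ S
  shift_notMem : ∀ i m, (i, m) ∉ S → 0 < affineHeight b (i, m) → (i, m + 1) ∉ S
  neg_notMem : ∀ i m n, (i, m) ∈ S → (P.reflectionPerm i i, n) ∉ S

omit [P.IsIrreducible] in
variable {b} in
-- The combinatorial counterpart of passing from `N(w)` to `N(s_a w)`; it drives the induction that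
-- realizes biconvex sets as inversion sets.
lemma IsBiconvex.affineRefl_image {S : Set (ι × ℤ)} (hS : IsBiconvex b S) {a : ι × ℤ}
    (ha : affineHeight b a = 1) (haS : a ∈ S) :
    IsBiconvex b ((fun c => affineRefl P a • c) '' (S \ {a})) := by
  have hmem : ∀ c, c ∈ (fun c => affineRefl P a • c) '' (S \ {a}) ↔
      affineRefl P a • c ∈ S ∧ c ≠ affineNeg P a := by
    intro c
    constructor
    · rintro ⟨d, ⟨hd, hda⟩, rfl⟩
      refine ⟨by simpa only [affineRefl_smul_smul] using hd, fun h => hda ?_⟩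
      have := congrArg (fun x => affineRefl P a • x) h
      simp only [affineRefl_smul_smul, smul_affineNeg, affineRefl_smul_self, affineNeg_neg] at this
      exact this
    · rintro ⟨h1, h2⟩
      refine ⟨_, ⟨h1, fun h => h2 ?_⟩, affineRefl_smul_smul (P := P) a c⟩
      rw [← affineRefl_smul_smul (P := P) a c, Set.mem_singleton_iff.1 h, affineRefl_smul_self]
  have hneg : affineNeg P a ∉ S := fun h => by
    have := hS.pos _ h
    rw [affineHeight_neg] at this
    lia
  have hne : ∀ c, 0 < affineHeight b c → c ≠ affineNeg P a := by
    rintro c hc rfl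
    rw [affineHeight_neg] at hc
    lia
  have hpos : ∀ c, affineRefl P a • c ∈ S → c ≠ affineNeg P a → 0 < affineHeight b c := by
    intro c h1 h2
    have := affineHeight_affineRefl_pos b ha (hS.pos _ h1) (fun h => h2 (by
      rw [← affineRefl_smul_smul (P := P) a c, h, affineRefl_smul_self]))
    rwa [affineRefl_smul_smul] at this
  constructor
  · intro c hc
    rw [hmem] at hc
    exact hpos c hc.1 hc.2
  · intro c hc d hd e he
    have he' := affineHeight_add b he
    rw [hmem] at hc hd ⊢
    refine ⟨hS.add_mem _ hc.1 _ hd.1 _ (affineVec_smul_add _ he), hne e ?_⟩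
    have := hpos c hc.1 hc.2
    have := hpos d hd.1 hd.2
    lia
  -- When one summand is `a`, coclosedness of `S` does not apply because `s_a a = -a`. Instead `s_a
  -- d = a + s_a e`, and closedness of `S` is used.
  · have main : ∀ d ∉ (fun c => affineRefl P a • c) '' (S \ {a}), ∀ e,
        affineVec P e = affineVec P a + affineVec P d →
        e ∉ (fun c => affineRefl P a • c) '' (S \ {a}) := by
      intro d hd e he heS
      rw [hmem] at hd heS
      have h1 : affineVec P (affineRefl P a • d) =
          affineVec P a + affineVec P (affineRefl P a • e) := by
        have := affineVec_smul_add (affineRefl P a) he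
        rw [this, affineRefl_smul_self, affineVec_neg]
        abel
      refine hd ⟨hS.add_mem _ haS _ heS.1 _ h1, ?_⟩
      rintro rfl
      rw [affineVec_neg, add_neg_cancel] at he
      exact P.ne_zero e.1 (congrArg Prod.fst he)
    intro c hcS hc d hdS hd e he
    by_cases hca : c = a
    · exact main d hdS e (hca ▸ he)
    by_cases hda : d = a
    · exact main c hcS e (by rw [he, hda, add_comm])
    rw [hmem] at hcS hdS ⊢
    have h1 : affineRefl P a • c ∉ S := fun h => hcS ⟨h, hne c hc⟩
    have h2 : affineRefl P a • d ∉ S := fun h => hdS ⟨h, hne d hd⟩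
    exact fun h => hS.add_notMem _ h1 (affineHeight_affineRefl_pos b ha hc hca) _ h2
      (affineHeight_affineRefl_pos b ha hd hda) _ (affineVec_smul_add _ he) h.1
  · intro i m hc hc0
    -- The reflection takes `a + δ` to `-a + δ`, which `neg_notMem` keeps out of `S`.
    by_cases hca : (i, m) = a
    · subst hca
      rw [hmem, smul_shift, affineRefl_smul_self]
      exact fun h => hS.neg_notMem i m _ haS h.1
    · rw [hmem] at hc ⊢
      have h1 : affineRefl P a • ((i, m) : ι × ℤ) ∉ S := fun h => hc ⟨h, hne _ hc0⟩
      rw [smul_shift]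
      exact fun h => hS.shift_notMem _ _ h1 (affineHeight_affineRefl_pos b ha hc0 hca) h.1
  · intro i m n hc hc'
    rw [hmem] at hc hc'
    rw [show ((P.reflectionPerm i i, n) : ι × ℤ) = affineNeg P (i, -n) by simp [affineNeg],
      smul_affineNeg, affineRefl_smul, affineNeg] at hc'
    rw [affineRefl_smul] at hc
    exact hS.neg_notMem _ _ _ hc.1 hc'.1

variable {b} in
/-- A finite biconvex set is the set of inversions of an element of the affine Weyl group. -/
lemma IsBiconvex.exists_inversionSet_eq {S : Set (ι × ℤ)} (hS : IsBiconvex b S) (hfin : S.Finite) :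
    ∃ w : AffineWeylGroup P, inversionSet b w = S := by
  generalize hn : S.ncard = n
  induction n generalizing S with
  | zero =>
    rw [Set.ncard_eq_zero hfin] at hn
    exact ⟨1, by rw [hn, inversionSet_one]⟩
  | succ n ih =>
    obtain ⟨a, haS, ha⟩ := exists_height_one_mem b hS.pos hS.add_notMem hS.shift_notMem
      (Set.nonempty_of_ncard_ne_zero (by lia))
    obtain ⟨w, hw⟩ := ih (hS.affineRefl_image ha haS) (hfin.sdiff.image _) (by
      rw [Set.ncard_image_of_injective _ (affineRefl_smul_injective a),
        Set.ncard_sdiff_singleton_of_mem haS, hn, Nat.add_sub_cancel])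
    have haw : a ∉ inversionSet b w := by
      rw [hw]
      rintro ⟨c, ⟨hc, -⟩, h⟩
      have h1 : c = affineNeg P a := by
        rw [← affineRefl_smul_smul (P := P) a c]
        change affineRefl P a • c = a at h
        rw [h, affineRefl_smul_self]
      have := hS.pos c hc
      rw [h1, affineHeight_neg] at this
      lia
    refine ⟨affineRefl P a * w, ?_⟩
    have h1 := inversionSet_eq_image b ha haw
    rw [hw] at h1
    have h2 := (affineRefl_smul_injective (P := P) a).image_injective h1
    have h3 := mem_inversionSet_affineRefl_mul b ha haw
    rw [← Set.insert_sdiff_self_of_mem h3, ← h2, Set.insert_sdiff_self_of_mem haS]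

end Inversions

/-! ### Biconvex sets from filtrations of the positive roots. -/

section Filtrations

variable {ι M N : Type*} [AddCommGroup M] [Module ℝ M] [AddCommGroup N] [Module ℝ N]
  {P : RootPairing ι ℝ M N} (b : P.Base)

/-- Decreasing filtrations of the positive roots that are compatible with sums of roots, as are the
complements of their steps. -/
structure IsRootFiltration (F : ℕ → Set ι) : Prop where
  zero : F 0 = {i | b.IsPos i}
  antitone : Antitone F
  add_mem : ∀ m n i j k, i ∈ F m → j ∈ F n → P.root k = P.root i + P.root j → k ∈ F (m + n)
  add_notMem : ∀ m n i j k, b.IsPos i → b.IsPos j → i ∉ F m → j ∉ F n →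
    P.root k = P.root i + P.root j → k ∉ F (m + n)
  exists_notMem : ∀ i, ∃ n, i ∉ F n

/-- The affine roots `α + m δ` with `m` positive and `α` in the `m`-th step of a filtration. -/
def affineSet (F : ℕ → Set ι) : Set (ι × ℤ) := {a | 0 < a.2 ∧ a.1 ∈ F a.2.toNat}

variable {b}

lemma IsRootFiltration.isPos {F : ℕ → Set ι} (hF : IsRootFiltration b F) {i : ι} {n : ℕ}
    (h : i ∈ F n) : b.IsPos i := by
  have := hF.antitone (Nat.zero_le n) h
  rwa [hF.zero] at this

lemma IsRootFiltration.finite_affineSet [Finite ι] {F : ℕ → Set ι} (hF : IsRootFiltration b F) :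
    (affineSet F).Finite := by
  choose n hn using hF.exists_notMem
  refine (Set.finite_iUnion fun i : ι =>
    (Set.finite_singleton i).prod (Set.finite_Icc (0 : ℤ) (n i))).subset ?_
  rintro ⟨i, m⟩ ⟨h1, h2⟩
  simp only at h1 h2
  refine Set.mem_iUnion.2 ⟨i, rfl, h1.le, ?_⟩
  by_contra h
  simp only [not_le] at h
  exact hn i (hF.antitone (by lia) h2)

lemma level_pos [Finite ι] {a : ι × ℤ} (ha : 0 < affineHeight b a) (h : b.IsPos a.1) :
    0 < a.2 := by
  rw [← isPosAffine_iff, IsPosAffine, isPos_neg_iff] at ha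
  tauto

lemma root_eq_add_neg {i j k : ι} (h : P.root k = P.root i + P.root j) :
    P.root i = P.root k + P.root (P.reflectionPerm j j) := by
  rw [root_neg, h]; abel

/-- The filtration axioms are the biconvexity conditions for finite parts that are positive. The
mixed cases follow from `F m + F 0 ⊆ F m`. -/
lemma IsRootFiltration.isBiconvex [Finite ι] {F : ℕ → Set ι} (hF : IsRootFiltration b F) :
    IsBiconvex b (affineSet F) := by
  constructor
  · exact fun a ha => affineHeight_pos_of_pos b ha.1
  · rintro a ⟨ha, ha'⟩ c ⟨hc, hc'⟩ d hd
    rw [affineVec_eq_add_iff] at hd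
    refine ⟨by lia, ?_⟩
    rw [hd.2, Int.toNat_add ha.le hc.le]
    exact hF.add_mem _ _ _ _ _ ha' hc' hd.1
  -- With `a.1` negative, `c.1 = d.1 + (-a.1)` with `-a.1` in `F 0`, and the level of `c` is at most
  -- that of `d`; so `d` in the set would put `c` there.
  · have main : ∀ a, 0 < affineHeight b a → ¬ b.IsPos a.1 → ∀ c ∉ affineSet F,
        0 < affineHeight b c → b.IsPos c.1 → ∀ d, affineVec P d = affineVec P a + affineVec P c →
        d ∉ affineSet F := by
      rintro a ha hapos c hc hc0 hcpos d hd ⟨h1, h2⟩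
      rw [affineVec_eq_add_iff] at hd
      have h3 := level_pos hc0 hcpos
      have h4 := nonneg_of_affineHeight_pos b ha
      refine hc ⟨h3, ?_⟩
      have h5 : P.reflectionPerm a.1 a.1 ∈ F 0 := by
        rw [hF.zero]
        exact (isPos_neg_iff b a.1).2 hapos
      have h6 := hF.add_mem _ _ _ _ _ (hF.antitone (show c.2.toNat ≤ d.2.toNat by lia) h2) h5
        (root_eq_add_neg (hd.1.trans (add_comm _ _)))
      exact h6
    intro a haS ha c hcS hc d hd
    by_cases hapos : b.IsPos a.1
    · by_cases hcpos : b.IsPos c.1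
      · rintro ⟨h1, h2⟩
        rw [affineVec_eq_add_iff] at hd
        have ha2 := level_pos ha hapos
        have hc2 := level_pos hc hcpos
        rw [hd.2, Int.toNat_add ha2.le hc2.le] at h2
        exact hF.add_notMem _ _ _ _ _ hapos hcpos (fun h => haS ⟨ha2, h⟩) (fun h => hcS ⟨hc2, h⟩)
          hd.1 h2
      · exact main c hc hcpos a haS ha hapos d (hd.trans (add_comm _ _))
    · by_cases hcpos : b.IsPos c.1
      · exact main a ha hapos c hcS hc hcpos d hd
      · rintro ⟨-, h2⟩
        rw [affineVec_eq_add_iff] at hd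
        have h3 := b.height_add hd.1
        have h4 := hF.isPos h2
        rw [RootPairing.Base.isPos_iff] at hapos hcpos h4
        lia
  · rintro i m h1 h2 ⟨h3, h4⟩
    have hpos := hF.isPos h4
    have h5 := level_pos h2 hpos
    exact h1 ⟨h5, hF.antitone (by simp only; lia) h4⟩
  · rintro i m n ⟨-, h1⟩ ⟨-, h2⟩
    exact (isPos_neg_iff b i).1 (hF.isPos h2) (hF.isPos h1)

lemma prec_of_add {i j k : ι} (hj : b.IsPos j) (h : P.root k = P.root i + P.root j) :
    Prec b i k := by
  refine ⟨?_, ?_⟩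
  · rintro rfl
    exact P.ne_zero j (by simpa using h)
  · rw [h, add_sub_cancel_left]
    exact AddSubmonoid.subset_closure ⟨j, hj, rfl⟩

lemma IsRootIdeal.add_mem {I : Set ι} (hI : IsRootIdeal b I) {i j k : ι} (hi : i ∈ I)
    (hj : b.IsPos j) (hk : P.root k = P.root i + P.root j) : k ∈ I :=
  hI.2 i hi j hj k ((hI.1 i hi).add hj hk) hk

end Filtrations

/-! ### Common refinements of two decompositions of a root. -/

section SumLemmas

variable {ι M N : Type*} [Finite ι] [AddCommGroup M] [Module ℝ M] [AddCommGroup N] [Module ℝ N]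
  {P : RootPairing ι ℝ M N} [P.IsCrystallographic] (b : P.Base)

/-- Two decompositions of a positive root into two positive roots have a common refinement. -/
lemma exists_refinement {i j k l p : ι} (hp : P.root p = P.root i + P.root j)
    (hp' : P.root p = P.root k + P.root l) :
    (i = k ∧ j = l) ∨ (i = l ∧ j = k) ∨
    (∃ r, b.IsPos r ∧ P.root i = P.root k + P.root r ∧ P.root l = P.root j + P.root r) ∨
    (∃ r, b.IsPos r ∧ P.root k = P.root i + P.root r ∧ P.root j = P.root l + P.root r) ∨
    (∃ r, b.IsPos r ∧ P.root i = P.root l + P.root r ∧ P.root k = P.root j + P.root r) ∨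
    (∃ r, b.IsPos r ∧ P.root l = P.root i + P.root r ∧ P.root j = P.root k + P.root r) := by
  have h := hp.symm.trans hp'
  have hj : P.root j = P.root k + P.root l - P.root i := by rw [← h]; abel
  rcases exists_sub_of_add_eq_add hp hp' with (rfl | ⟨r, hr⟩) | (rfl | ⟨r, hr⟩)
  · exact Or.inl ⟨rfl, P.root.injective (add_left_cancel h)⟩
  · by_cases hpos : b.IsPos r
    · exact Or.inr (Or.inr (Or.inl ⟨r, hpos, by rw [hr]; abel, by rw [hr, hj]; abel⟩))
    · refine Or.inr (Or.inr (Or.inr (Or.inl ⟨_, (isPos_neg_iff b r).2 hpos, ?_, ?_⟩)))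
      · rw [root_neg, hr]; abel
      · rw [root_neg, hr, hj]; abel
  · refine Or.inr (Or.inl ⟨rfl, P.root.injective ?_⟩)
    rw [hj]; abel
  · by_cases hpos : b.IsPos r
    · exact Or.inr (Or.inr (Or.inr (Or.inr (Or.inl ⟨r, hpos, by rw [hr]; abel,
        by rw [hr, hj]; abel⟩))))
    · refine Or.inr (Or.inr (Or.inr (Or.inr (Or.inr ⟨_, (isPos_neg_iff b r).2 hpos, ?_, ?_⟩))))
      · rw [root_neg, hr]; abel
      · rw [root_neg, hr, hj]; abel

end SumLemmas

/-! ### Powers of an ideal: the inversions of the minimal element. -/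

section IdealPowers

variable {ι M N : Type*} [AddCommGroup M] [Module ℝ M] [AddCommGroup N] [Module ℝ N]
  {P : RootPairing ι ℝ M N} (b : P.Base)

/-- The roots that are sums of `n` roots of the ideal `I`; all positive roots for `n = 0`. -/
def idealPow (I : Set ι) : ℕ → Set ι
  | 0 => {i | b.IsPos i}
  | n + 1 => {i | i ∈ I ∧
      (n = 0 ∨ ∃ j ∈ idealPow I n, ∃ k ∈ I, P.root i = P.root j + P.root k)}

variable {b} {I : Set ι}

lemma idealPow_one : idealPow b I 1 = I := by
  ext i
  simp [idealPow]

lemma IsRootIdeal.isPos_of_mem_idealPow (hI : IsRootIdeal b I) {n : ℕ} {i : ι}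
    (h : i ∈ idealPow b I n) : b.IsPos i := by
  cases n with
  | zero => exact h
  | succ n => exact hI.1 i h.1

lemma IsRootIdeal.mem_idealPow_succ (hI : IsRootIdeal b I) {n : ℕ} {i j k : ι}
    (hi : i ∈ idealPow b I n) (hj : j ∈ I) (h : P.root k = P.root i + P.root j) :
    k ∈ idealPow b I (n + 1) :=
  ⟨hI.add_mem hj (hI.isPos_of_mem_idealPow hi) (h.trans (add_comm _ _)),
    Or.inr ⟨i, hi, j, hj, h⟩⟩

lemma IsRootIdeal.le_height (hI : IsRootIdeal b I) {n : ℕ} {i : ι} (h : i ∈ idealPow b I n) :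
    (n : ℤ) ≤ b.height i := by
  induction n generalizing i with
  | zero =>
    have : b.IsPos i := h
    rw [RootPairing.Base.isPos_iff] at this
    simpa using this.le
  | succ n ih =>
    have h1 := hI.1 i h.1
    rw [RootPairing.Base.isPos_iff] at h1
    rcases h.2 with rfl | ⟨j, hj, k, hk, hjk⟩
    · lia
    · have h2 := ih hj
      have h3 := hI.1 k hk
      rw [RootPairing.Base.isPos_iff] at h3
      rw [b.height_add hjk]
      push_cast
      lia

variable [Finite ι] [P.IsCrystallographic]

/-- By `exists_add_of_add_add`, the extra root can be absorbed into one of the two summands of `i`,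
keeping every partial sum a root. -/
lemma IsRootIdeal.mem_idealPow_add_isPos (hI : IsRootIdeal b I) {n : ℕ} {i j k : ι}
    (hi : i ∈ idealPow b I n) (hj : b.IsPos j) (h : P.root k = P.root i + P.root j) :
    k ∈ idealPow b I n := by
  induction n generalizing i j k with
  | zero => exact RootPairing.Base.IsPos.add hi hj h
  | succ n ih =>
    rcases hi.2 with rfl | ⟨u, hu, v, hv, huv⟩
    · exact ⟨hI.add_mem hi.1 hj h, Or.inl rfl⟩
    · rcases exists_add_of_add_add b (hI.isPos_of_mem_idealPow hu) (hI.1 v hv) hj huv h with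
        ⟨r, hr⟩ | ⟨r, hr⟩
      · exact hI.mem_idealPow_succ (ih hu hj hr) hv (by rw [h, huv, hr]; abel)
      · exact hI.mem_idealPow_succ hu (hI.add_mem hv hj hr) (by rw [h, huv, hr]; abel)

lemma IsRootIdeal.mem_idealPow_add (hI : IsRootIdeal b I) {m n : ℕ} {i j k : ι}
    (hi : i ∈ idealPow b I m) (hj : j ∈ idealPow b I n) (h : P.root k = P.root i + P.root j) :
    k ∈ idealPow b I (m + n) := by
  induction m generalizing i j k n with
  | zero =>
    rw [zero_add]
    exact hI.mem_idealPow_add_isPos hj hi (h.trans (add_comm _ _))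
  | succ m ih =>
    rcases hi.2 with rfl | ⟨u, hu, v, hv, huv⟩
    · rw [zero_add, add_comm]
      exact hI.mem_idealPow_succ hj hi.1 (h.trans (add_comm _ _))
    · rcases exists_add_of_add_add b (hI.isPos_of_mem_idealPow hu) (hI.1 v hv)
        (hI.isPos_of_mem_idealPow hj) huv h with ⟨r, hr⟩ | ⟨r, hr⟩
      · rw [add_right_comm]
        exact hI.mem_idealPow_succ (ih hu hj hr) hv (by rw [h, huv, hr]; abel)
      · rw [add_assoc, add_comm 1 n]
        exact ih hu (hI.mem_idealPow_succ hj hv (hr.trans (add_comm _ _)))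
          (by rw [h, huv, hr]; abel)

lemma IsRootIdeal.antitone_idealPow (hI : IsRootIdeal b I) : Antitone (idealPow b I) := by
  refine antitone_nat_of_succ_le fun n i hi => ?_
  rcases hi.2 with rfl | ⟨u, hu, v, hv, huv⟩
  · exact hI.1 i hi.1
  · exact hI.mem_idealPow_add_isPos hu (hI.1 v hv) huv

/-- Refining `k = i + j` against a decomposition of `k` into `n + 1` roots of `I` cuts at most one
of these roots. The others are shared out between `i` and `j`, hence the loss of one. -/
lemma IsRootIdeal.exists_split_idealPow (hI : IsRootIdeal b I) {n : ℕ} {i j k : ι}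
    (hi : b.IsPos i) (hj : b.IsPos j) (h : P.root k = P.root i + P.root j)
    (hk : k ∈ idealPow b I (n + 1)) :
    ∃ p q, p + q = n ∧ i ∈ idealPow b I p ∧ j ∈ idealPow b I q := by
  induction n generalizing i j k with
  | zero => exact ⟨0, 0, rfl, hi, hj⟩
  | succ n ih =>
    rcases hk.2 with h0 | ⟨u, hu, v, hv, huv⟩
    · lia
    rcases exists_refinement b h huv with ⟨rfl, rfl⟩ | ⟨rfl, rfl⟩ | ⟨r, hr, h1, h2⟩ |
      ⟨r, hr, h1, h2⟩ | ⟨r, hr, h1, h2⟩ | ⟨r, hr, h1, h2⟩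
    · exact ⟨n + 1, 0, rfl, hu, hj⟩
    · exact ⟨0, n + 1, by lia, hi, hu⟩
    · exact ⟨n + 1, 0, rfl, hI.mem_idealPow_add_isPos hu hr h1, hj⟩
    · obtain ⟨p, q, hpq, hp, hq⟩ := ih hi hr h1 hu
      exact ⟨p, q + 1, by lia, hp, hI.mem_idealPow_succ hq hv (h2.trans (add_comm _ _))⟩
    · obtain ⟨p, q, hpq, hp, hq⟩ := ih hj hr h2 hu
      exact ⟨q + 1, p, by lia, hI.mem_idealPow_succ hq hv (h1.trans (add_comm _ _)), hp⟩
    · exact ⟨0, n + 1, by lia, hi, hI.mem_idealPow_add_isPos hu hr h2⟩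

lemma IsRootIdeal.isRootFiltration_idealPow (hI : IsRootIdeal b I) :
    IsRootFiltration b (idealPow b I) := by
  refine ⟨rfl, hI.antitone_idealPow, fun m n i j k hi hj h => hI.mem_idealPow_add hi hj h, ?_, ?_⟩
  · intro m n i j k hi hj him hjn h hk
    cases m with
    | zero => exact him hi
    | succ m =>
      rw [add_right_comm] at hk
      obtain ⟨p, q, hpq, hp, hq⟩ := hI.exists_split_idealPow hi hj h hk
      rcases (by lia : m + 1 ≤ p ∨ n ≤ q) with h1 | h1
      · exact him (hI.antitone_idealPow h1 hp)
      · exact hjn (hI.antitone_idealPow h1 hq)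
  · intro i
    refine ⟨(b.height i).toNat + 1, fun h => ?_⟩
    have := hI.le_height h
    lia

omit [Finite ι] [P.IsCrystallographic] in
lemma notMem_of_mem_minimalRoots {i j k : ι} (hI : IsRootIdeal b I) (hi : i ∈ minimalRoots b I)
    (hk : b.IsPos k) (h : P.root i = P.root j + P.root k) : j ∉ I :=
  fun hj => hi.2 j (hI.1 j hj) (prec_of_add hk h) hj

/-- Removing a minimal root costs at most one factor: the refinements in which `i` strictly contains
a root of `I` are excluded by minimality. -/
lemma IsRootIdeal.mem_idealPow_of_add_minimal (hI : IsRootIdeal b I) {n : ℕ} {i j k : ι}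
    (hi : i ∈ minimalRoots b I) (hj : b.IsPos j) (h : P.root k = P.root i + P.root j)
    (hk : k ∈ idealPow b I (n + 1)) : j ∈ idealPow b I n := by
  induction n generalizing j k with
  | zero => exact hj
  | succ n ih =>
    rcases hk.2 with h0 | ⟨u, hu, v, hv, huv⟩
    · lia
    rcases exists_refinement b h huv with ⟨rfl, rfl⟩ | ⟨rfl, rfl⟩ | ⟨r, hr, h1, h2⟩ |
      ⟨r, hr, h1, h2⟩ | ⟨r, hr, h1, h2⟩ | ⟨r, hr, h1, h2⟩
    · rcases hu.2 with rfl | ⟨u', hu', v', hv', huv'⟩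
      · exact ⟨hv, Or.inl rfl⟩
      · exact absurd hv' (notMem_of_mem_minimalRoots hI hi (hI.isPos_of_mem_idealPow hu')
          (huv'.trans (add_comm _ _)))
    · exact hu
    · exact absurd hu.1 (notMem_of_mem_minimalRoots hI hi hr h1)
    · exact hI.mem_idealPow_succ (ih hr h1 hu) hv (h2.trans (add_comm _ _))
    · exact absurd hv (notMem_of_mem_minimalRoots hI hi hr h1)
    · exact hI.mem_idealPow_add_isPos hu hr h2

end IdealPowers

/-! ### Sums of roots outside an ideal: the inversions of the maximal element. -/

section ComplementSums

variable {ι M N : Type*} [AddCommGroup M] [Module ℝ M] [AddCommGroup N] [Module ℝ N]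
  {P : RootPairing ι ℝ M N} (b : P.Base)

/-- The positive roots that are sums of at most `n` positive roots outside `I`. -/
def complSums (I : Set ι) : ℕ → Set ι
  | 0 => ∅
  | n + 1 => {i | b.IsPos i ∧ (i ∉ I ∨ i ∈ complSums I n ∨
      ∃ j ∈ complSums I n, ∃ k, b.IsPos k ∧ k ∉ I ∧ P.root i = P.root j + P.root k)}

variable {b} {I : Set ι}

lemma mem_complSums_one {i : ι} : i ∈ complSums b I 1 ↔ b.IsPos i ∧ i ∉ I := by
  simp [complSums]

lemma isPos_of_mem_complSums {n : ℕ} {i : ι} (h : i ∈ complSums b I n) : b.IsPos i := by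
  cases n with
  | zero => exact h.elim
  | succ n => exact h.1

lemma monotone_complSums : Monotone (complSums b I) :=
  monotone_nat_of_le_succ fun _ _ h => ⟨isPos_of_mem_complSums h, Or.inr (Or.inl h)⟩

lemma mem_complSums_of_notMem {n : ℕ} {i : ι} (h : b.IsPos i) (h' : i ∉ I) (hn : n ≠ 0) :
    i ∈ complSums b I n := by
  obtain ⟨n, rfl⟩ := Nat.exists_eq_succ_of_ne_zero hn
  exact ⟨h, Or.inl h'⟩

lemma mem_complSums_succ {n : ℕ} {i j k : ι} (hi : i ∈ complSums b I n) (hj : b.IsPos j)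
    (hj' : j ∉ I) (h : P.root k = P.root i + P.root j) : k ∈ complSums b I (n + 1) :=
  ⟨(isPos_of_mem_complSums hi).add hj h, Or.inr (Or.inr ⟨i, hi, j, hj, hj', h⟩)⟩

lemma ne_zero_of_mem_complSums {n : ℕ} {i : ι} (h : i ∈ complSums b I n) : n ≠ 0 := by
  rintro rfl
  exact h

variable [Finite ι] [P.IsCrystallographic]

lemma mem_complSums_add {m n : ℕ} {i j k : ι} (hi : i ∈ complSums b I m)
    (hj : j ∈ complSums b I n) (h : P.root k = P.root i + P.root j) :
    k ∈ complSums b I (m + n) := by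
  induction m generalizing i j k n with
  | zero => exact hi.elim
  | succ m ih =>
    rcases hi.2 with hi' | hi' | ⟨u, hu, v, hv, hv', huv⟩
    · exact monotone_complSums (show n + 1 ≤ m + 1 + n by lia)
        (mem_complSums_succ hj hi.1 hi' (h.trans (add_comm _ _)))
    · exact monotone_complSums (show m + n ≤ m + 1 + n by lia) (ih hi' hj h)
    · rcases exists_add_of_add_add b (isPos_of_mem_complSums hu) hv
        (isPos_of_mem_complSums hj) huv h with ⟨r, hr⟩ | ⟨r, hr⟩
      · rw [add_right_comm]
        exact mem_complSums_succ (ih hu hj hr) hv hv' (by rw [h, huv, hr]; abel)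
      · rw [add_assoc, add_comm 1 n]
        exact ih hu (mem_complSums_succ hj hv hv' (hr.trans (add_comm _ _)))
          (by rw [h, huv, hr]; abel)

/-- Dual to `exists_split_idealPow`. A summand cut by the refinement leaves a piece on both sides,
each outside `I` because `I` is an ideal, so it may be counted twice: hence `n + 1`. -/
lemma IsRootIdeal.exists_split_complSums (hI : IsRootIdeal b I) {n : ℕ} {i j k : ι}
    (hi : b.IsPos i) (hj : b.IsPos j) (h : P.root k = P.root i + P.root j)
    (hk : k ∈ complSums b I n) :
    ∃ p q, p + q ≤ n + 1 ∧ i ∈ complSums b I p ∧ j ∈ complSums b I q := by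
  have hdown : ∀ {i j k : ι}, b.IsPos i → b.IsPos j → P.root k = P.root i + P.root j → k ∉ I →
      i ∈ complSums b I 1 ∧ j ∈ complSums b I 1 := fun hi hj h hk =>
    ⟨mem_complSums_one.2 ⟨hi, fun hi' => hk (hI.add_mem hi' hj h)⟩,
      mem_complSums_one.2 ⟨hj, fun hj' => hk (hI.add_mem hj' hi (h.trans (add_comm _ _)))⟩⟩
  induction n generalizing i j k with
  | zero => exact hk.elim
  | succ n ih =>
    rcases hk.2 with hk' | hk' | ⟨u, hu, v, hv, hv', huv⟩
    · exact ⟨1, 1, by lia, hdown hi hj h hk'⟩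
    · obtain ⟨p, q, hpq, hp, hq⟩ := ih hi hj h hk'
      exact ⟨p, q, by lia, hp, hq⟩
    rcases exists_refinement b h huv with ⟨rfl, rfl⟩ | ⟨rfl, rfl⟩ | ⟨r, hr, h1, h2⟩ |
      ⟨r, hr, h1, h2⟩ | ⟨r, hr, h1, h2⟩ | ⟨r, hr, h1, h2⟩
    · exact ⟨n, 1, by lia, hu, mem_complSums_one.2 ⟨hv, hv'⟩⟩
    · exact ⟨1, n, by lia, mem_complSums_one.2 ⟨hv, hv'⟩, hu⟩
    · obtain ⟨hj', hr'⟩ := hdown hj hr h2 hv'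
      exact ⟨n + 1, 1, by lia, mem_complSums_add hu hr' h1, hj'⟩
    · obtain ⟨p, q, hpq, hp, hq⟩ := ih hi hr h1 hu
      exact ⟨p, q + 1, by lia, hp, mem_complSums_succ hq hv hv' (h2.trans (add_comm _ _))⟩
    · obtain ⟨p, q, hpq, hp, hq⟩ := ih hj hr h2 hu
      exact ⟨q + 1, p, by lia, mem_complSums_succ hq hv hv' (h1.trans (add_comm _ _)), hp⟩
    · obtain ⟨hi', hr'⟩ := hdown hi hr h1 hv'
      exact ⟨1, n + 1, by lia, hi', mem_complSums_add hu hr' h2⟩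

lemma IsRootIdeal.mem_complSums_of_add (hI : IsRootIdeal b I) {n : ℕ} {i j k : ι}
    (hi : b.IsPos i) (hj : b.IsPos j) (h : P.root k = P.root i + P.root j)
    (hk : k ∈ complSums b I n) : i ∈ complSums b I n := by
  obtain ⟨p, q, hpq, hp, hq⟩ := hI.exists_split_complSums hi hj h hk
  have := ne_zero_of_mem_complSums hq
  exact monotone_complSums (by lia) hp

/-- The role of strict positivity: all simple roots are available as summands, so the complementary
filtration ends and its affine set is finite. -/
lemma IsStrictlyPositive.exists_mem_complSums (hI : IsStrictlyPositive b I) {i : ι}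
    (hi : b.IsPos i) : ∃ n, i ∈ complSums b I n := by
  refine hi.induction_on_add (p := fun i => ∃ n, i ∈ complSums b I n) ?_ ?_
  · intro i hi
    exact ⟨1, mem_complSums_one.2 ⟨RootPairing.Base.isPos_of_mem_support hi, hI i hi⟩⟩
  · rintro i j k hk ⟨n, hn⟩ hj
    exact ⟨n + 1, mem_complSums_succ hn (RootPairing.Base.isPos_of_mem_support hj) (hI j hj) hk⟩

/-- Taking complements exchanges the two axioms: splitting sums gives closedness, and adding sums
gives coclosedness. -/
lemma IsRootIdeal.isRootFiltration_complSums (hI : IsRootIdeal b I)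
    (hI' : IsStrictlyPositive b I) :
    IsRootFiltration b (fun n => {i | b.IsPos i ∧ i ∉ complSums b I n}) := by
  refine ⟨by simp [complSums], ?_, ?_, ?_, ?_⟩
  · exact fun m n hmn i hi => ⟨hi.1, fun h => hi.2 (monotone_complSums hmn h)⟩
  · rintro m n i j k ⟨hi, hi'⟩ ⟨hj, hj'⟩ h
    refine ⟨hi.add hj h, fun hk => ?_⟩
    obtain ⟨p, q, hpq, hp, hq⟩ := hI.exists_split_complSums hi hj h hk
    rcases (by lia : p ≤ m ∨ q ≤ n) with h1 | h1
    · exact hi' (monotone_complSums h1 hp)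
    · exact hj' (monotone_complSums h1 hq)
  · rintro m n i j k hi hj hi' hj' h hk
    have h1 : i ∈ complSums b I m := by by_contra h1; exact hi' ⟨hi, h1⟩
    have h2 : j ∈ complSums b I n := by by_contra h2; exact hj' ⟨hj, h2⟩
    exact hk.2 (mem_complSums_add h1 h2 h)
  · intro i
    by_cases hi : b.IsPos i
    · obtain ⟨n, hn⟩ := hI'.exists_mem_complSums hi
      exact ⟨n, fun h => h.2 hn⟩
    · exact ⟨0, fun h => hi h.1⟩

/-- By maximality, anything strictly above `i` of the form `i + r` is in `I`. So `i` is never a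
proper part of a summand, and removing it saves one summand. -/
lemma IsRootIdeal.mem_complSums_of_add_maximal (hI : IsRootIdeal b I) {n : ℕ} {i j k : ι}
    (hi : i ∈ maximalRootsCompl b I) (hj : b.IsPos j) (h : P.root k = P.root i + P.root j)
    (hk : k ∈ complSums b I (n + 1)) : j ∈ complSums b I n := by
  have hmax : ∀ {r k : ι}, b.IsPos r → P.root k = P.root i + P.root r → k ∈ I := by
    intro r k hr hk
    by_contra hkI
    exact hi.2.2 k (hi.1.add hr hk) hkI (prec_of_add hr hk)
  induction n generalizing j k with
  | zero => exact absurd (hmax hj h) (mem_complSums_one.1 hk).2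
  | succ n ih =>
    rcases hk.2 with hk' | hk' | ⟨u, hu, v, hv, hv', huv⟩
    · exact absurd (hmax hj h) hk'
    · exact monotone_complSums (Nat.le_succ n) (ih hj h hk')
    rcases exists_refinement b h huv with ⟨rfl, rfl⟩ | ⟨rfl, rfl⟩ | ⟨r, hr, h1, h2⟩ |
      ⟨r, hr, h1, h2⟩ | ⟨r, hr, h1, h2⟩ | ⟨r, hr, h1, h2⟩
    · exact mem_complSums_of_notMem hv hv' (by lia)
    · exact hu
    · exact mem_complSums_of_notMem hj (fun h3 => hv' (hI.add_mem h3 hr h2)) (by lia)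
    · exact mem_complSums_succ (ih hr h1 hu) hv hv' (h2.trans (add_comm _ _))
    · exact hI.mem_complSums_of_add hj hr h2 hu
    · exact absurd (hmax hr h1) hv'

end ComplementSums

/-! ### Extreme elements of a sign type and their walls. -/

section SignTypes

variable {ι M N : Type*} [Finite ι] [AddCommGroup M] [Module ℝ M] [AddCommGroup N] [Module ℝ N]
  {P : RootPairing ι ℝ M N} [P.IsCrystallographic] {b : P.Base} {I : Set ι}

lemma affineHeight_inv_smul_pos {w : AffineWeylGroup P} {a : ι × ℤ} (ha : 0 < affineHeight b a)
    (h : a ∉ inversionSet b w) : 0 < affineHeight b (w⁻¹ • a) := by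
  have := affineHeight_ne_zero b (w⁻¹ • a)
  rw [mem_inversionSet_iff] at h
  lia

/-- The elements of a sign type contained in the positive roots are dominant. -/
lemma affineHeight_inv_smul_neg (hI : IsRootIdeal b I) {u : AffineWeylGroup P}
    (hu : u ∈ signType b I) {i : ι} (hi : b.IsPos i) : affineHeight b (u⁻¹ • ((i, 0) : ι × ℤ)) < 0 := by
  have h1 : (P.reflectionPerm i i, 0) ∉ inversionSet b u := fun h => by
    have : P.reflectionPerm i i ∈ I := by rw [← hu]; exact ⟨0, h⟩
    exact (isPos_neg_iff b i).1 (hI.1 _ this) hi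
  have h2 : 0 < affineHeight b (P.reflectionPerm i i, 0) := by
    rw [RootPairing.Base.isPos_iff] at hi
    simpa [affineHeight, height_neg] using hi
  have h3 := affineHeight_inv_smul_pos h2 h1
  have h4 := affineHeight_smul_neg b u⁻¹ (i, 0)
  simp only [affineNeg, neg_zero] at h4
  lia

lemma affineHeight_inv_smul_one_neg (hI : IsRootIdeal b I) {u : AffineWeylGroup P}
    (hu : u ∈ signType b I) {i : ι} (hi : i ∈ I) : affineHeight b (u⁻¹ • ((i, 1) : ι × ℤ)) < 0 := by
  have h1 := hi
  rw [← hu] at h1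
  obtain ⟨m, hm⟩ := h1
  rw [mem_inversionSet_iff] at hm
  have h2 := level_pos hm.1 (hI.1 i hi)
  have h3 := affineHeight_smul_shift b u⁻¹ i 1 (m - 1)
  rw [add_sub_cancel] at h3
  have : 0 ≤ (coxeterNumber b : ℤ) * (m - 1) := mul_nonneg (by lia) (by simp only at h2; lia)
  lia

lemma affineHeight_inv_smul_one_pos {u : AffineWeylGroup P}
    (hu : u ∈ signType b I) {i : ι} (hi : i ∉ I) : 0 < affineHeight b (u⁻¹ • ((i, 1) : ι × ℤ)) := by
  refine affineHeight_inv_smul_pos (affineHeight_pos_of_pos b (by simp)) fun h => hi ?_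
  rw [← hu]
  exact ⟨1, h⟩

omit [Finite ι] in
lemma supp_eq_of_inversionSet_eq {F : ℕ → Set ι} (hF : IsRootFiltration b F)
    {w : AffineWeylGroup P} (hw : inversionSet b w = affineSet F) : supp b w = F 1 := by
  ext i
  rw [supp, hw]
  constructor
  · rintro ⟨m, h1, h2⟩
    exact hF.antitone (by simp only at h1 ⊢; lia) h2
  · exact fun h => ⟨1, by simp, h⟩

variable [P.IsRootSystem]

/-- The inversions of an element of the sign type of `I` contain `α + n δ` for `α` a sum of `n` roots
of `I`. -/
lemma affineSet_idealPow_subset (hI : IsRootIdeal b I) {u : AffineWeylGroup P}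
    (hu : u ∈ signType b I) : affineSet (idealPow b I) ⊆ inversionSet b u := by
  have key : ∀ n : ℕ, ∀ i ∈ idealPow b I (n + 1),
      affineHeight b (u⁻¹ • ((i, (n : ℤ) + 1) : ι × ℤ)) < 0 := by
    intro n
    induction n with
    | zero =>
      intro i hi
      simpa using affineHeight_inv_smul_one_neg hI hu hi.1
    | succ n ih =>
      intro i hi
      rcases hi.2 with h0 | ⟨j, hj, k, hk, hjk⟩
      · lia
      have h1 := affineHeight_smul_add b u⁻¹ (a := (j, (n : ℤ) + 1)) (d := (k, 1))
        (c := (i, ((n + 1 : ℕ) : ℤ) + 1)) (affineVec_eq_add_iff.2 ⟨hjk, by push_cast; ring⟩)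
      have h2 := ih j hj
      have h3 := affineHeight_inv_smul_one_neg hI hu hk
      lia
  rintro ⟨i, m⟩ ⟨h1, h2⟩
  simp only at h1 h2
  rw [mem_inversionSet_iff]
  refine ⟨affineHeight_pos_of_pos b h1, ?_⟩
  obtain ⟨n, hn⟩ : ∃ n : ℕ, m = (n : ℤ) + 1 := ⟨(m - 1).toNat, by lia⟩
  subst hn
  have h3 : ((n : ℤ) + 1).toNat = n + 1 := by lia
  exact key n i (h3 ▸ h2)

/-- The inversions of an element of the sign type of `I` do not contain `α + n δ` for `α` a sum of at
most `n` positive roots outside `I`. -/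
lemma inversionSet_subset_affineSet (hI : IsRootIdeal b I) {u : AffineWeylGroup P}
    (hu : u ∈ signType b I) : inversionSet b u ⊆
      affineSet (fun n => {i | b.IsPos i ∧ i ∉ complSums b I n}) := by
  have key : ∀ n : ℕ, ∀ i ∈ complSums b I n, 0 < affineHeight b (u⁻¹ • ((i, (n : ℤ)) : ι × ℤ)) := by
    intro n
    induction n with
    | zero => exact fun i hi => hi.elim
    | succ n ih =>
      intro i hi
      rcases hi.2 with hi' | hi' | ⟨j, hj, k, hk, hk', hjk⟩
      · have h1 := affineHeight_inv_smul_one_pos hu hi'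
        have h2 := affineHeight_smul_shift b u⁻¹ i 1 n
        push_cast
        rw [add_comm (n : ℤ) 1, h2]
        positivity
      · have h1 := ih i hi'
        have h2 := affineHeight_smul_shift b u⁻¹ i n 1
        push_cast
        rw [h2]
        positivity
      · have h1 := affineHeight_smul_add b u⁻¹ (a := (j, (n : ℤ))) (d := (k, 1))
          (c := (i, ((n + 1 : ℕ) : ℤ))) (affineVec_eq_add_iff.2 ⟨hjk, by push_cast; ring⟩)
        have h2 := ih j hj
        have h3 := affineHeight_inv_smul_one_pos hu hk'
        lia
  rintro ⟨i, m⟩ h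
  have hi : i ∈ I := by rw [← hu]; exact ⟨m, h⟩
  rw [mem_inversionSet_iff] at h
  have h1 := level_pos h.1 (hI.1 i hi)
  refine ⟨h1, hI.1 i hi, fun h2 => ?_⟩
  have h3 := key _ i h2
  simp only at h1 h3
  rw [Int.toNat_of_nonneg h1.le] at h3
  lia

/-- In a sign type, `w⁻¹` increases the affine heights of `α + δ` strictly along `≺`, up to sign. -/
lemma affineHeight_lt_of_prec (hI : IsRootIdeal b I) {u : AffineWeylGroup P}
    (hu : u ∈ signType b I) {i j : ι} (hij : Prec b i j) (m : ℤ) :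
    affineHeight b (u⁻¹ • ((j, m) : ι × ℤ)) < affineHeight b (u⁻¹ • ((i, m) : ι × ℤ)) := by
  obtain ⟨f, hf⟩ := exists_affineHeightFunctional b u⁻¹
  have key : ∀ x ∈ AddSubmonoid.closure (P.root '' {k | b.IsPos k}), x = 0 ∨ f (x, 0) < 0 := by
    intro x hx
    induction hx using AddSubmonoid.closure_induction with
    | mem x hx =>
      obtain ⟨k, hk, rfl⟩ := hx
      have h1 := hf (k, 0)
      have h2 := affineHeight_inv_smul_neg hI hu hk
      simp only [affineVec, Int.cast_zero] at h1
      rw [h1]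
      exact Or.inr (by exact_mod_cast h2)
    | zero => exact Or.inl rfl
    | add x y _ _ hx hy =>
      have : f (x + y, 0) = f (x, 0) + f (y, 0) := by
        rw [← map_add]; simp
      rcases hx with rfl | hx <;> rcases hy with rfl | hy
      · simp
      · simp [hy]
      · simp [hx]
      · rw [this]; exact Or.inr (add_neg hx hy)
  rcases key _ hij.2 with h | h
  · exact absurd (P.root.injective (sub_eq_zero.1 h)).symm hij.1
  · have h1 : affineVec P (j, m) = affineVec P (i, m) + (P.root j - P.root i, 0) := by
      simp [affineVec]
    have h2 := congrArg f h1
    rw [map_add, hf, hf] at h2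
    have : (affineHeight b (u⁻¹ • ((j, m) : ι × ℤ)) : ℝ) <
        affineHeight b (u⁻¹ • ((i, m) : ι × ℤ)) := by linarith
    exact_mod_cast this

variable [P.IsReduced] [P.IsIrreducible]

/-- `N(w)` is contained in every inversion set of the sign type, so equal length forces equal
inversion sets. -/
lemma IsRootIdeal.isMinElement_iff (hI : IsRootIdeal b I) {w : AffineWeylGroup P}
    (hw : inversionSet b w = affineSet (idealPow b I)) {u : AffineWeylGroup P} :
    IsMinElement b I u ↔ u = w := by
  have hmem : w ∈ signType b I := by
    have := supp_eq_of_inversionSet_eq hI.isRootFiltration_idealPow hw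
    rwa [idealPow_one] at this
  have hsub : ∀ v ∈ signType b I, inversionSet b w ⊆ inversionSet b v := fun v hv => by
    rw [hw]; exact affineSet_idealPow_subset hI hv
  constructor
  · rintro ⟨h1, h2⟩
    have h3 := h2 w hmem
    rw [length_eq_ncard_inversionSet, length_eq_ncard_inversionSet] at h3
    exact (inversionSet_injective b
      (Set.eq_of_subset_of_ncard_le (hsub u h1) h3 (finite_inversionSet b u))).symm
  · rintro rfl
    refine ⟨hmem, fun v hv => ?_⟩
    rw [length_eq_ncard_inversionSet, length_eq_ncard_inversionSet]
    exact Set.ncard_le_ncard (hsub v hv) (finite_inversionSet b v)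

lemma IsRootIdeal.isMaxElement_iff (hI : IsRootIdeal b I) (hI' : IsStrictlyPositive b I)
    {w : AffineWeylGroup P}
    (hw : inversionSet b w = affineSet (fun n => {i | b.IsPos i ∧ i ∉ complSums b I n}))
    {u : AffineWeylGroup P} : IsMaxElement b I u ↔ u = w := by
  have hmem : w ∈ signType b I := by
    have := supp_eq_of_inversionSet_eq (hI.isRootFiltration_complSums hI') hw
    rw [signType, Set.mem_ofPred_eq, this]
    ext i
    simp only [mem_complSums_one, Set.mem_ofPred_eq]
    constructor
    · rintro ⟨h1, h2⟩
      by_contra h3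
      exact h2 ⟨h1, h3⟩
    · exact fun h => ⟨hI.1 i h, fun h' => h'.2 h⟩
  have hsub : ∀ v ∈ signType b I, inversionSet b v ⊆ inversionSet b w := fun v hv => by
    rw [hw]; exact inversionSet_subset_affineSet hI hv
  constructor
  · rintro ⟨h1, h2⟩
    have h3 := h2 w hmem
    rw [length_eq_ncard_inversionSet, length_eq_ncard_inversionSet] at h3
    exact inversionSet_injective b
      (Set.eq_of_subset_of_ncard_le (hsub u h1) h3 (finite_inversionSet b w))
  · rintro rfl
    refine ⟨hmem, fun v hv => ?_⟩
    rw [length_eq_ncard_inversionSet, length_eq_ncard_inversionSet]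
    exact Set.ncard_le_ncard (hsub v hv) (finite_inversionSet b _)

omit [P.IsReduced] [P.IsIrreducible] in
/-- The walls of the alcove of the minimal element do not lie above the level one. -/
lemma level_le_one_of_min {w : AffineWeylGroup P}
    (hw : inversionSet b w = affineSet (idealPow b I)) {p : ι × ℤ}
    (hp : affineHeight b (w⁻¹ • p) = -1) : p.2 ≤ 1 := by
  obtain ⟨i, m⟩ := p
  by_contra hlt
  simp only [not_le] at hlt
  have h1 : (i, m) ∈ affineSet (idealPow b I) := by
    rw [← hw, mem_inversionSet_iff]
    exact ⟨affineHeight_pos_of_pos b (by simp only; lia), by lia⟩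
  obtain ⟨n, rfl⟩ : ∃ n : ℕ, m = (n : ℤ) + 2 := ⟨(m - 2).toNat, by lia⟩
  have h2 : i ∈ idealPow b I (n + 1 + 1) := h1.2
  rcases h2.2 with h0 | ⟨j, hj, k, hk, hjk⟩
  · lia
  have hneg : ∀ a ∈ affineSet (idealPow b I), affineHeight b (w⁻¹ • a) < 0 := fun a ha => by
    rw [← hw, mem_inversionSet_iff] at ha
    exact ha.2
  have h3 := hneg (j, (n : ℤ) + 1) ⟨by simp only; lia,
    (by lia : n + 1 = ((n : ℤ) + 1).toNat) ▸ hj⟩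
  have h4 := hneg (k, 1) ⟨by simp, by rw [Int.toNat_one, idealPow_one]; exact hk⟩
  have h5 := affineHeight_smul_add b w⁻¹ (a := (j, (n : ℤ) + 1)) (d := (k, 1))
    (c := (i, (n : ℤ) + 2)) (affineVec_eq_add_iff.2 ⟨hjk, by ring⟩)
  lia

omit [P.IsReduced] [P.IsIrreducible] in
/-- The walls of the alcove of the maximal element do not lie above the level one. -/
lemma level_le_one_of_max {w : AffineWeylGroup P}
    (hw : inversionSet b w = affineSet (fun n => {i | b.IsPos i ∧ i ∉ complSums b I n}))
    (hmem : w ∈ signType b I) {p : ι × ℤ}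
    (hp : affineHeight b (w⁻¹ • p) = 1) : p.2 ≤ 1 := by
  obtain ⟨i, m⟩ := p
  by_contra hlt
  simp only [not_le] at hlt
  have hpos : ∀ k, ∀ n : ℕ, k ∈ complSums b I n →
      0 < affineHeight b (w⁻¹ • ((k, (n : ℤ)) : ι × ℤ)) := by
    intro k n hk
    have hn := ne_zero_of_mem_complSums hk
    refine affineHeight_inv_smul_pos (affineHeight_pos_of_pos b (by simp only; lia)) ?_
    rw [hw]
    rintro ⟨-, h⟩
    exact h.2 (by simpa using hk)
  obtain ⟨n, rfl⟩ : ∃ n : ℕ, m = (n : ℤ) + 2 := ⟨(m - 2).toNat, by lia⟩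
  -- One level lower the height is `1 - h < 0`. So `i` needs exactly `n + 2` summands from the
  -- complement, and splitting off the last one writes `1` as a sum of two positive integers.
  have h0 : (i, (n : ℤ) + 1) ∈ inversionSet b w := by
    rw [mem_inversionSet_iff]
    refine ⟨affineHeight_pos_of_pos b (by simp only; lia), ?_⟩
    have h1 := affineHeight_smul_shift b w⁻¹ i ((n : ℤ) + 1) 1
    rw [add_assoc, show (1 : ℤ) + 1 = 2 by norm_num, hp] at h1
    have : Nonempty ι := ⟨i⟩
    have := two_le_coxeterNumber b
    lia
  rw [hw] at h0
  have h1 : i ∉ complSums b I (n + 1) := h0.2.2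
  have hi : b.IsPos i := h0.2.1
  have h2 : i ∈ complSums b I (n + 1 + 1) := by
    by_contra h2
    have : (i, (n : ℤ) + 2) ∈ inversionSet b w := by
      rw [hw]
      exact ⟨by simp only; lia, hi, h2⟩
    rw [mem_inversionSet_iff] at this
    lia
  rcases h2.2 with h3 | h3 | ⟨j, hj, k, hk, hk', hjk⟩
  · exact h1 (mem_complSums_of_notMem hi h3 (by lia))
  · exact h1 h3
  have h3 := hpos j (n + 1) hj
  have h4 := affineHeight_inv_smul_one_pos hmem hk'
  have h5 := affineHeight_smul_add b w⁻¹ (a := (j, ((n + 1 : ℕ) : ℤ))) (d := (k, 1))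
    (c := (i, (n : ℤ) + 2)) (affineVec_eq_add_iff.2 ⟨hjk, by push_cast; ring⟩)
  lia

/-- The minimal roots of an ideal correspond to the walls of the alcove of the minimal element that
separate it from the fundamental alcove. -/
lemma IsRootIdeal.mem_minimalRoots_iff (hI : IsRootIdeal b I) {w : AffineWeylGroup P}
    (hw : inversionSet b w = affineSet (idealPow b I)) (hmem : w ∈ signType b I) {i : ι} :
    i ∈ minimalRoots b I ↔ affineHeight b (w⁻¹ • ((i, 1) : ι × ℤ)) = -1 := by
  have hneg : ∀ a, a ∈ affineSet (idealPow b I) ↔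
      0 < affineHeight b a ∧ affineHeight b (w⁻¹ • a) < 0 := fun a => by
    rw [← hw, mem_inversionSet_iff]
  constructor
  · intro hi
    have h1 := affineHeight_inv_smul_one_neg hI hmem hi.1
    by_contra hne
    set a := affineNeg P (w⁻¹ • ((i, 1) : ι × ℤ)) with ha
    have h2 := affineHeight_neg b (w⁻¹ • ((i, 1) : ι × ℤ))
    rw [← ha] at h2
    -- Here `p` is an inversion. If `q` were positive too, both levels would be at least one, but
    -- they add up to one. So `q` has level `-n` with `p` at level `n + 1`; either `p.1` is a root
    -- of `I` below `i`, or cancelling `i` makes `-q` an inversion, against `w⁻¹ q < 0`.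
    have key : ∀ p q : ι × ℤ, affineVec P (i, 1) = affineVec P p + affineVec P q →
        affineHeight b (w⁻¹ • p) < 0 → affineHeight b (w⁻¹ • q) < 0 → 0 < affineHeight b p →
        False := by
      rintro ⟨j, n⟩ ⟨k, m⟩ h hp hq hp0
      rw [affineVec_eq_add_iff] at h
      obtain ⟨h4, h5⟩ := h
      obtain ⟨h6, h7⟩ := (hneg _).2 ⟨hp0, hp⟩
      simp only at h4 h5 h6 h7
      by_cases hq0 : 0 < affineHeight b (k, m)
      · have := ((hneg _).2 ⟨hq0, hq⟩).1
        simp only at this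
        lia
      obtain ⟨n, rfl⟩ : ∃ l : ℕ, n = (l : ℤ) + 1 := ⟨(n - 1).toNat, by lia⟩
      have h7 : j ∈ idealPow b I (n + 1) := h7
      obtain rfl : m = -n := by lia
      by_cases hk : b.IsPos k
      · exact notMem_of_mem_minimalRoots hI hi hk h4 h7.1
      · rw [← isPos_neg_iff] at hk
        have h8 := hI.mem_idealPow_of_add_minimal hi hk (root_eq_add_neg h4) h7
        have h9 := affineHeight_neg b (k, -(n : ℤ))
        have h10 := affineHeight_smul_neg b w⁻¹ (k, -(n : ℤ))
        have h11 := affineHeight_ne_zero b (k, -(n : ℤ))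
        simp only [affineNeg, neg_neg] at h9 h10
        have h12 : (P.reflectionPerm k k, (n : ℤ)) ∈ affineSet (idealPow b I) :=
          ⟨level_pos (by lia) hk, h8⟩
        have := ((hneg _).1 h12).2
        lia
    rcases exists_decomposition b (a := a) (by lia) with ⟨c, d, hv, hc, hd⟩ | hd
    · have h3 : affineVec P (i, 1) =
          affineVec P (w • affineNeg P c) + affineVec P (w • affineNeg P d) := by
        rw [smul_affineNeg, smul_affineNeg, affineVec_neg, affineVec_neg, ← neg_add,
          ← affineVec_smul_add w hv, ha, smul_affineNeg, smul_inv_smul, affineVec_neg, neg_neg]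
      have e1 : affineHeight b (w⁻¹ • w • affineNeg P c) < 0 := by
        rw [inv_smul_smul, affineHeight_neg]; lia
      have e2 : affineHeight b (w⁻¹ • w • affineNeg P d) < 0 := by
        rw [inv_smul_smul, affineHeight_neg]; lia
      have h4 := affineHeight_add b h3
      have h5 := affineHeight_pos_of_pos b (a := (i, 1)) (by simp)
      rcases (by lia : 0 < affineHeight b (w • affineNeg P c) ∨
        0 < affineHeight b (w • affineNeg P d)) with h6 | h6
      · exact key _ _ h3 e1 e2 h6
      · exact key _ _ (h3.trans (add_comm _ _)) e2 e1 h6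
    · have h3 := affineHeight_shift b a.1 (a.2 - 1) 1
      rw [sub_add_cancel] at h3
      -- If `δ` can be split off, `i + 2δ` is still an inversion, so `i` is a sum of two roots of
      -- `I` and not minimal.
      change affineHeight b a = _ at h3
      have h4 := affineHeight_smul_shift b w⁻¹ i 1 1
      have h5 : (i, (1 : ℤ) + 1) ∈ affineSet (idealPow b I) :=
        (hneg _).2 ⟨affineHeight_pos_of_pos b (by simp), by lia⟩
      have h6 : i ∈ idealPow b I 2 := h5.2
      rcases h6.2 with h7 | ⟨j, hj, k, hk, hjk⟩
      · lia
      · exact notMem_of_mem_minimalRoots hI hi (hI.1 k hk) hjk hj.1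
  · intro h
    have h1 : (i, 1) ∈ affineSet (idealPow b I) :=
      (hneg _).2 ⟨affineHeight_pos_of_pos b (by simp), by lia⟩
    refine ⟨h1.2.1, fun j hj hji hjI => ?_⟩
    have h2 := affineHeight_lt_of_prec hI hmem hji 1
    have h3 := affineHeight_inv_smul_one_neg hI hmem hjI
    lia

/-- The maximal roots of the complement of a strictly positive ideal correspond to the walls of the
alcove of the maximal element that do not separate it from the fundamental alcove. -/
lemma IsRootIdeal.mem_maximalRootsCompl_iff (hI : IsRootIdeal b I) {w : AffineWeylGroup P}
    (hw : inversionSet b w = affineSet (fun n => {i | b.IsPos i ∧ i ∉ complSums b I n}))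
    (hmem : w ∈ signType b I) {i : ι} (hipos : b.IsPos i) :
    i ∈ maximalRootsCompl b I ↔ affineHeight b (w⁻¹ • ((i, 1) : ι × ℤ)) = 1 := by
  constructor
  · intro hi
    have hmax : ∀ {r k : ι}, b.IsPos r → P.root k = P.root i + P.root r → k ∈ I := by
      intro r k hr hk
      by_contra hkI
      exact hi.2.2 k (hipos.add hr hk) hkI (prec_of_add hr hk)
    have h1 := affineHeight_inv_smul_one_pos hmem hi.2.1
    by_contra hne
    set a := w⁻¹ • ((i, 1) : ι × ℤ) with ha
    have key : ∀ p q : ι × ℤ, affineVec P (i, 1) = affineVec P p + affineVec P q →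
        0 < affineHeight b (w⁻¹ • p) → 0 < affineHeight b (w⁻¹ • q) → b.IsPos p.1 → False := by
      rintro ⟨j, n⟩ ⟨k, m⟩ h hp hq hj
      rw [affineVec_eq_add_iff] at h
      obtain ⟨h4, h5⟩ := h
      simp only at h4 h5 hj
      -- Dominance: `w⁻¹` makes every `α + m δ` with `α` positive and `m ≤ 0` negative. The same
      -- fact later excludes a positive `k`.
      have hn : 0 < n := by
        by_contra hn
        have h6 := affineHeight_inv_smul_neg hI hmem hj
        have h7 := affineHeight_smul_shift b w⁻¹ j n (-n)
        rw [add_neg_cancel] at h7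
        have : 0 ≤ (coxeterNumber b : ℤ) * (-n) := mul_nonneg (by lia) (by lia)
        lia
      obtain ⟨n, rfl⟩ : ∃ l : ℕ, n = (l : ℤ) + 1 := ⟨(n - 1).toNat, by lia⟩
      obtain rfl : m = -n := by lia
      have hjC : j ∈ complSums b I (n + 1) := by
        by_contra hjC
        have : (j, (n : ℤ) + 1) ∈ inversionSet b w := by
          rw [hw]
          exact ⟨hn, hj, hjC⟩
        rw [mem_inversionSet_iff] at this
        lia
      by_cases hk : b.IsPos k
      · have h6 := affineHeight_inv_smul_neg hI hmem hk
        have h7 := affineHeight_smul_shift b w⁻¹ k (-(n : ℤ)) n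
        rw [neg_add_cancel] at h7
        have : 0 ≤ (coxeterNumber b : ℤ) * n := by positivity
        lia
      · rw [← isPos_neg_iff] at hk
        have h8 := hI.mem_complSums_of_add_maximal hi hk (root_eq_add_neg h4) hjC
        have hn0 := ne_zero_of_mem_complSums h8
        have h9 := affineHeight_smul_neg b w⁻¹ (k, -(n : ℤ))
        simp only [affineNeg, neg_neg] at h9
        have h10 : (P.reflectionPerm k k, (n : ℤ)) ∉ inversionSet b w := by
          rw [hw]
          rintro ⟨-, h11⟩
          exact h11.2 h8
        have h11 := affineHeight_inv_smul_pos (affineHeight_pos_of_pos b (by simp only; lia)) h10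
        lia
    rcases exists_decomposition b (a := a) (by lia) with ⟨c, d, hv, hc, hd⟩ | hd
    · have h3 : affineVec P (i, 1) = affineVec P (w • c) + affineVec P (w • d) := by
        rw [← affineVec_smul_add w hv, ha, smul_inv_smul]
      have h4 := b.height_add (affineVec_eq_add_iff.1 h3).1
      rw [RootPairing.Base.isPos_iff] at hipos
      simp only at h4
      rcases (by lia : 0 < b.height (w • c).1 ∨ 0 < b.height (w • d).1) with h5 | h5
      · exact key _ _ h3 (by rwa [inv_smul_smul]) (by rwa [inv_smul_smul]) h5
      · exact key _ _ (h3.trans (add_comm _ _)) (by rwa [inv_smul_smul])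
          (by rwa [inv_smul_smul]) h5
    · have h3 := affineHeight_shift b a.1 (a.2 - 1) 1
      rw [sub_add_cancel] at h3
      change affineHeight b a = _ at h3
      -- Splitting off `δ` would make `w⁻¹` of the finite root `i` positive, against dominance.
      have h4 := affineHeight_smul_shift b w⁻¹ i 0 1
      rw [zero_add, ← ha] at h4
      have h5 := affineHeight_inv_smul_neg hI hmem hipos
      lia
  · intro h
    refine ⟨hipos, fun hi => ?_, fun j hj hjI hij => ?_⟩
    · have := affineHeight_inv_smul_one_neg hI hmem hi
      lia
    · have h2 := affineHeight_lt_of_prec hI hmem hij 1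
      have h3 := affineHeight_inv_smul_one_pos hmem hjI
      lia

end SignTypes

/-! ### Walls in the coordinates `x τ_λ`: the sets `D^t` and `B_{t,λ}`. -/

section Simplices

variable {ι M N : Type*} [Finite ι] [Nonempty ι] [AddCommGroup M] [Module ℝ M] [AddCommGroup N]
  [Module ℝ N] {P : RootPairing ι ℝ M N} [P.IsCrystallographic] (b : P.Base)

omit [Finite ι] [Nonempty ι] in
lemma mulTranslation_inv_smul (x : P.weylGroup) (l : P.corootSpan ℤ) (i : ι) (m : ℤ) :
    (mulTranslation P x l)⁻¹ • ((i, m) : ι × ℤ) = (x⁻¹ • i, m - P.root'In ℤ (x⁻¹ • i) l) := by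
  rw [inv_smul_eq_iff, mulTranslation_smul, smul_inv_smul, sub_add_cancel]

omit [P.IsCrystallographic] in
lemma coxeterNumber_add_one_mod : (coxeterNumber b + 1) % coxeterNumber b = 1 := by
  have := two_le_coxeterNumber b
  rw [Nat.add_mod_left, Nat.mod_eq_of_lt (by lia)]

omit [P.IsCrystallographic] in
lemma coxeterNumber_add_one_div : (coxeterNumber b + 1) / coxeterNumber b = 1 := by
  have := two_le_coxeterNumber b
  rw [Nat.add_div_left _ (by lia), Nat.div_eq_of_lt (by lia)]

omit [P.IsCrystallographic] in
lemma coxeterNumber_sub_one_mod :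
    (coxeterNumber b - 1) % coxeterNumber b = coxeterNumber b - 1 := by
  have := two_le_coxeterNumber b
  exact Nat.mod_eq_of_lt (by lia)

omit [P.IsCrystallographic] in
lemma coxeterNumber_sub_one_div : (coxeterNumber b - 1) / coxeterNumber b = 0 := by
  have := two_le_coxeterNumber b
  exact Nat.div_eq_of_lt (by lia)

/-- The roots defining `D^{h+1}` are the finite parts of the affine roots of height `-1`: height `1`
at level `0` and height `1 - h` at level `-1`. The translation adds `⟨α, λ⟩` to the level. -/
lemma mem_latticeSimplex_add_one {x : P.weylGroup} {l : P.corootSpan ℤ}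
    (h : ∀ p, affineHeight b ((mulTranslation P x l)⁻¹ • p) = -1 → p.2 ≤ 1) :
    l ∈ latticeSimplex b (coxeterNumber b + 1) := by
  rw [latticeSimplex, coxeterNumber_add_one_mod, coxeterNumber_add_one_div]
  constructor
  · intro i hi
    have := h (mulTranslation P x l • (i, 0)) (by
      rw [inv_smul_smul, affineHeight, hi]; simp)
    rw [mulTranslation_smul] at this
    simpa using this
  · intro i hi
    have := h (mulTranslation P x l • (i, -1)) (by
      rw [inv_smul_smul, affineHeight, hi]; push_cast; ring)
    rw [mulTranslation_smul] at this
    push_cast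
    simp only at this
    lia

/-- Now the affine roots have height `1`: finite height `h - 1` at level `1`, and `-1` at level `0`.
-/
lemma mem_latticeSimplex_sub_one {x : P.weylGroup} {l : P.corootSpan ℤ}
    (h : ∀ p, affineHeight b ((mulTranslation P x l)⁻¹ • p) = 1 → p.2 ≤ 1) :
    l ∈ latticeSimplex b (coxeterNumber b - 1) := by
  have h2 := two_le_coxeterNumber b
  rw [latticeSimplex, coxeterNumber_sub_one_mod, coxeterNumber_sub_one_div]
  constructor
  · intro i hi
    have := h (mulTranslation P x l • (i, 1)) (by
      rw [inv_smul_smul, affineHeight, hi]; push_cast [show 1 ≤ coxeterNumber b by lia]; ring)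
    rw [mulTranslation_smul] at this
    push_cast
    simp only at this
    lia
  · intro i hi
    have := h (mulTranslation P x l • (i, 0)) (by
      rw [inv_smul_smul, affineHeight, hi]; push_cast [show 1 ≤ coxeterNumber b by lia]; ring)
    rw [mulTranslation_smul] at this
    simpa using this

lemma mem_wallRoots_add_one_iff (x : P.weylGroup) (l : P.corootSpan ℤ) (i : ι) :
    x⁻¹ • i ∈ wallRoots b (coxeterNumber b + 1) l ↔
      affineHeight b ((mulTranslation P x l)⁻¹ • ((i, 1) : ι × ℤ)) = -1 := by
  rw [wallRoots, coxeterNumber_add_one_mod, coxeterNumber_add_one_div, mulTranslation_inv_smul]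
  have h2 := two_le_coxeterNumber b
  set j := x⁻¹ • i
  set m := P.root'In ℤ j l
  have h3 := height_lt_coxeterNumber b j
  have h4 := neg_coxeterNumber_lt_height b j
  simp only [Set.mem_union, Set.mem_ofPred_eq, affineHeight, Nat.cast_one]
  change (b.height j = 1 ∧ m = 1) ∨ (b.height j = 1 - (coxeterNumber b : ℤ) ∧ m = 1 + 1) ↔ _
  constructor
  · rintro (⟨h5, h6⟩ | ⟨h5, h6⟩) <;> rw [h5, h6] <;> ring
  · intro h
    -- The equation is `h (1 - m) - ht = -1`; the bound `|ht| < h` leaves only `m = 1` and `m = 2`.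
    have h5 : m < 3 := by
      by_contra hm
      nlinarith
    have h6 : 0 < m := by
      by_contra hm
      nlinarith
    rcases (by lia : m = 1 ∨ m = 2) with h7 | h7 <;> rw [h7] at h
    · exact Or.inl ⟨by lia, h7⟩
    · exact Or.inr ⟨by lia, h7⟩

lemma mem_wallRoots_sub_one_iff (x : P.weylGroup) (l : P.corootSpan ℤ) (i : ι) :
    x⁻¹ • i ∈ wallRoots b (coxeterNumber b - 1) l ↔
      affineHeight b ((mulTranslation P x l)⁻¹ • ((i, 1) : ι × ℤ)) = 1 := by
  rw [wallRoots, coxeterNumber_sub_one_mod, coxeterNumber_sub_one_div, mulTranslation_inv_smul]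
  have h2 := two_le_coxeterNumber b
  set j := x⁻¹ • i
  set m := P.root'In ℤ j l
  have h3 := height_lt_coxeterNumber b j
  have h4 := neg_coxeterNumber_lt_height b j
  simp only [Set.mem_union, Set.mem_ofPred_eq, affineHeight, Nat.cast_zero,
    Nat.cast_sub (show 1 ≤ coxeterNumber b by lia), Nat.cast_one]
  change (b.height j = (coxeterNumber b : ℤ) - 1 ∧ m = 0) ∨
    (b.height j = (coxeterNumber b : ℤ) - 1 - (coxeterNumber b : ℤ) ∧ m = 0 + 1) ↔ _
  constructor
  · rintro (⟨h5, h6⟩ | ⟨h5, h6⟩) <;> rw [h5, h6] <;> ring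
  · intro h
    -- Likewise `h (1 - m) - ht = 1` leaves only `m = 0` and `m = 1`.
    have h5 : m < 2 := by
      by_contra hm
      nlinarith
    have h6 : -1 < m := by
      by_contra hm
      nlinarith
    rcases (by lia : m = 0 ∨ m = 1) with h7 | h7 <;> rw [h7] at h
    · exact Or.inl ⟨by lia, h7⟩
    · exact Or.inr ⟨by lia, h7⟩

end Simplices

end ShiIdeal

end

/-! ### The minimal and maximal elements of a sign type. -/

theorem mainTheorem4 {ι M N : Type*} [Finite ι] [AddCommGroup M] [Module ℝ M]
    [AddCommGroup N] [Module ℝ N] (P : RootPairing ι ℝ M N) [P.IsRootSystem]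
    [P.IsCrystallographic] [P.IsReduced] [P.IsIrreducible] (b : P.Base)
    (I : Set ι) (hI : ShiIdeal.IsRootIdeal b I) :
    ((∃! w, ShiIdeal.IsMinElement b I w) ∧
      ∀ (x : P.weylGroup) (l : P.corootSpan ℤ),
        ShiIdeal.IsMinElement b I (ShiIdeal.mulTranslation P x l) →
          l ∈ ShiIdeal.latticeSimplex b (ShiIdeal.coxeterNumber b + 1) ∧
          ∀ i, b.IsPos i → (i ∈ ShiIdeal.minimalRoots b I ↔
            x⁻¹ • i ∈ ShiIdeal.wallRoots b (ShiIdeal.coxeterNumber b + 1) l)) ∧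
    (ShiIdeal.IsStrictlyPositive b I →
      (∃! w, ShiIdeal.IsMaxElement b I w) ∧
      ∀ (x : P.weylGroup) (l : P.corootSpan ℤ),
        ShiIdeal.IsMaxElement b I (ShiIdeal.mulTranslation P x l) →
          l ∈ ShiIdeal.latticeSimplex b (ShiIdeal.coxeterNumber b - 1) ∧
          ∀ i, b.IsPos i → (i ∈ ShiIdeal.maximalRootsCompl b I ↔
            x⁻¹ • i ∈ ShiIdeal.wallRoots b (ShiIdeal.coxeterNumber b - 1) l)) := by
  obtain ⟨t, -⟩ := ShiIdeal.exists_isHighestRoot b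
  -- A root exists, so `h ≥ 2` and division of `h ± 1` by `h` gives the stated `(a, b)`.
  have : Nonempty ι := ⟨t⟩
  constructor
  · have hF := hI.isRootFiltration_idealPow
    obtain ⟨w, hw⟩ := hF.isBiconvex.exists_inversionSet_eq hF.finite_affineSet
    refine ⟨⟨w, (hI.isMinElement_iff hw).2 rfl, fun u hu => (hI.isMinElement_iff hw).1 hu⟩, ?_⟩
    intro x l hmin
    have hwx := (hI.isMinElement_iff hw).1 hmin
    rw [← hwx] at hw
    refine ⟨ShiIdeal.mem_latticeSimplex_add_one b fun p hp => ShiIdeal.level_le_one_of_min hw hp, fun i _ => ?_⟩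
    rw [ShiIdeal.mem_wallRoots_add_one_iff, hI.mem_minimalRoots_iff hw hmin.1]
  · intro hI'
    have hF := hI.isRootFiltration_complSums hI'
    obtain ⟨w, hw⟩ := hF.isBiconvex.exists_inversionSet_eq hF.finite_affineSet
    refine ⟨⟨w, (hI.isMaxElement_iff hI' hw).2 rfl,
      fun u hu => (hI.isMaxElement_iff hI' hw).1 hu⟩, ?_⟩
    intro x l hmax
    have hwx := (hI.isMaxElement_iff hI' hw).1 hmax
    rw [← hwx] at hw
    refine ⟨ShiIdeal.mem_latticeSimplex_sub_one b fun p hp => ShiIdeal.level_le_one_of_max hw hmax.1 hp,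
      fun i hi => ?_⟩
    rw [ShiIdeal.mem_wallRoots_sub_one_iff, hI.mem_maximalRootsCompl_iff hw hmax.1 hi]
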